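/- **Lemma (Delocalizing transport in the critical Ising model).** For $V\ge 1$ consider on $(\mathbb C^2)^{\otimes V}$ the critical Ising Hamiltonian with periodic boundary conditions, $H_{\mathrm{IS}}=-\sum_{j=1}^V X_jX_{j+1}-\sum_{j=1}^V Z_j$ (site $V+1$ is site $1$), and the Jordan--Wigner fermions $f_j=\bigl(\prod_{l<j}Z_l\bigr)\tfrac12(X_j+\mathrm iY_j)$, so that $Z_j=1-2f_j^\dagger f_j$. Put $c=(f_1,f_1^\dagger,\dots,f_V,f_V^\dagger)$ and let $m=\Omega c$ be the Majorana operators $m_{2j-1}=(f_j^\dagger+f_j)/\sqrt2$, $m_{2j}=\mathrm i(f_j^\dagger-f_j)/\sqrt2$, where $\Omega=\frac1{\sqrt2}\bigoplus_{j=1}^V\begin{pmatrix}1&1\\-\mathrm i&\mathrm i\end{pmatrix}$. For $\sigma\in\{1,-1\}$ let $$H^\sigma=\mathrm i\sum_{j,k=1}^{2V}m_jK^\sigma_{j,k}m_k,\qquad K^\sigma=B^\sigma-(B^\sigma)^T,$$ where $B^\sigma$ is the $2V\times 2V$ matrix with entries $1$ at the positions $(j,j+1)$, $1\le j<2V$,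 an entry $\sigma$ added at position $(1,2V)$, and zeros elsewhere. Let $h^\sigma=\mathrm i\,\Omega^\dagger K^\sigma\Omega$ and let $W^\sigma(t)=\mathrm e^{-2\mathrm i th^\sigma}$ be the propagator. There is a constant $C_{\mathrm{Trans}}>0$, independent of $V$ and $\sigma$, such that for all $V\ge1$ and $\sigma\in\{1,-1\}$: 1. $H^\sigma$ is the critical Ising Hamiltonian in the parity sector $\sigma$: $H_{\mathrm{IS}}\psi=H^\sigma\psi$ whenever $\prod_{j=1}^V(1-2f_j^\dagger f_j)\,\psi=\sigma\psi$; 2. $W^\sigma$ is the propagator of $H^\sigma$: $\mathrm e^{\mathrm iH^\sigma t}c_j\,\mathrm e^{-\mathrm iH^\sigma t}=\sum_{k=1}^{2V}W^\sigma_{j,k}(t)\,c_k$ for all real $t$ and all $j$; 3. for all $t\in(0,V^{6/7}]$ and all $j,k\in\{1,\dots,2V\}$, $$|W^\sigma_{j,k}(t)|\le C_{\mathrm{Trans}}\,t^{-1/3}.$$ -/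

import Mathlib

open Matrix

noncomputable section

namespace CriticalIsing

/-! ## Spin chain of `V` sites on `(ℂ²)^{⊗V}`, with basis the configurations `Fin V → Fin 2` -/

/-- Operators on `(ℂ²)^{⊗V}`, as matrices in the product basis. -/
abbrev Op (V : ℕ) : Type := Matrix (Fin V → Fin 2) (Fin V → Fin 2) ℂ

/-- The single-site operator `1 ⊗ ⋯ ⊗ A ⊗ ⋯ ⊗ 1` with `A` acting on site `j`. -/
def onSite {V : ℕ} (j : Fin V) (A : Matrix (Fin 2) (Fin 2) ℂ) : Op V :=
  fun s s' => if ∀ l, l ≠ j → s l = s' l then A (s j) (s' j) else 0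

/-- The Pauli matrix `X`. -/
def pauliX : Matrix (Fin 2) (Fin 2) ℂ := !![0, 1; 1, 0]

/-- The Pauli matrix `Y`. -/
def pauliY : Matrix (Fin 2) (Fin 2) ℂ := !![0, -Complex.I; Complex.I, 0]

/-- The Pauli matrix `Z`. -/
def pauliZ : Matrix (Fin 2) (Fin 2) ℂ := !![1, 0; 0, -1]

/-- The transverse field Ising Hamiltonian `-∑ⱼ Xⱼ Xⱼ₊₁ - g ∑ⱼ Zⱼ` with periodic boundary
conditions (`finRotate V` is the cyclic successor on the sites). -/
def isingHamiltonian (V : ℕ) (g : ℝ) : Op V :=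
  -(∑ j : Fin V, onSite j pauliX * onSite (finRotate V j) pauliX)
    - (g : ℂ) • ∑ j : Fin V, onSite j pauliZ

/-! ## Jordan–Wigner fermions -/

/-- The Jordan–Wigner string `∏_{l < j} Z_l`; this product of diagonal matrices is diagonal. -/
def jwString {V : ℕ} (j : Fin V) : Op V :=
  Matrix.diagonal fun s => ∏ l ∈ Finset.univ.filter (fun l => l < j), (-1 : ℂ) ^ (s l).val

/-- The fermionic annihilation operator `f_j = (∏_{l < j} Z_l) (X_j + i Y_j) / 2`; it lowers the
occupation number of site `j` from `1` to `0`, and `1 - 2 f_jᴴ f_j = Z_j`. The creation operator is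
its adjoint. -/
def annihilation {V : ℕ} (j : Fin V) : Op V :=
  jwString j * onSite j ((1 / 2 : ℂ) • (pauliX + Complex.I • pauliY))

/-- The parity operator `∏_l (1 - 2 n_l) = ∏_l Z_l`. -/
def parityOp (V : ℕ) : Op V :=
  Matrix.diagonal fun s => ∏ l, (-1 : ℂ) ^ (s l).val

/-- The vector `c = (f₁, f₁†, …, f_V, f_V†)`. The index `a : Fin (V * 2)` (counted from `0`) has site
`a.divNat = ⌊a / 2⌋` and position `a.modNat = a mod 2` inside the site. -/
def cOp {V : ℕ} (a : Fin (V * 2)) : Op V :=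
  if a.modNat = 0 then annihilation a.divNat else (annihilation a.divNat)ᴴ

/-- The vector of Majorana operators: `(f_j† + f_j) / √2` and `i (f_j† - f_j) / √2` for each site,
so that `{m_a, m_b} = δ_{a,b}`. -/
def majorana {V : ℕ} (a : Fin (V * 2)) : Op V :=
  if a.modNat = 0 then
    ((Real.sqrt 2 : ℂ))⁻¹ • ((annihilation a.divNat)ᴴ + annihilation a.divNat)
  else
    (Complex.I * ((Real.sqrt 2 : ℂ))⁻¹) • ((annihilation a.divNat)ᴴ - annihilation a.divNat)

/-! ## The quadratic fermionic model and its propagator -/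

/-- The entries above the diagonal of the Ising kernel (indices from `0`): `g, 1, g, 1, …, g` next to
the diagonal, and `σ` in the upper right corner. For `V = 1` the two entries add up to `g + σ`. -/
def isingUpper (V : ℕ) (g σ : ℝ) : Matrix (Fin (V * 2)) (Fin (V * 2)) ℝ :=
  fun a b =>
    (if a.val + 1 = b.val then (if a.modNat = 0 then g else 1) else 0)
      + (if a.val = 0 ∧ b.val + 1 = V * 2 then σ else 0)

/-- The real antisymmetric kernel `K^σ` of the Ising model in the parity sector `σ`. -/
def isingKernel (V : ℕ) (g σ : ℝ) : Matrix (Fin (V * 2)) (Fin (V * 2)) ℝ :=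
  isingUpper V g σ - (isingUpper V g σ)ᵀ

/-- The fermionic Hamiltonian `H^σ = i ∑_{j,k} m_j K^σ_{j,k} m_k`. -/
def sectorHamiltonian (V : ℕ) (g σ : ℝ) : Op V :=
  Complex.I • ∑ a : Fin (V * 2), ∑ b : Fin (V * 2),
    (isingKernel V g σ a b : ℂ) • (majorana a * majorana b)

/-- The unitary block matrix `Ω` with blocks `(1, 1; -i, i) / √2`, for which `m = Ω c`. -/
def omega (V : ℕ) : Matrix (Fin (V * 2)) (Fin (V * 2)) ℂ :=
  fun a b =>
    if a.divNat = b.divNat then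
      ((Real.sqrt 2 : ℂ))⁻¹ * !![(1 : ℂ), 1; -Complex.I, Complex.I] a.modNat b.modNat
    else 0

/-- The coupling matrix `h` with `H^σ = ∑_{j,k} c_j† h_{j,k} c_k`; it is determined by
`K^σ = -i Ω h Ω†`, that is `h = i Ω† K^σ Ω`. -/
def coupling (V : ℕ) (g σ : ℝ) : Matrix (Fin (V * 2)) (Fin (V * 2)) ℂ :=
  Complex.I • ((omega V)ᴴ * (isingKernel V g σ).map (fun x : ℝ => (x : ℂ)) * omega V)

/-- The propagator `W^σ(t) = exp(-2 i t h)`. -/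
def propagator (V : ℕ) (g σ t : ℝ) : Matrix (Fin (V * 2)) (Fin (V * 2)) ℂ :=
  NormedSpace.exp ((-2 * Complex.I * (t : ℂ)) • coupling V g σ)

/-- Heisenberg evolution `A(t) = e^{iHt} A e^{-iHt}`. -/
def heisenberg {V : ℕ} (H A : Op V) (t : ℝ) : Op V :=
  NormedSpace.exp ((Complex.I * (t : ℂ)) • H) * A * NormedSpace.exp ((-Complex.I * (t : ℂ)) • H)

end CriticalIsing

end

noncomputable section

namespace CriticalIsing

/-! ## Single-site operators -/

/-! The first two claims are algebra. Up to the factor `1 / √2`, the Majorana operators are Pauli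
matrices `X`, `Y` dressed by strings, so they satisfy `majorana_anticomm`. Each quadratic term of
`H^σ` collapses to a spin term, except that the bond across the boundary carries the parity operator
(`sectorHamiltonian_succ`), which equals `σ` in the sector. The commutator of `H^σ` with a Majorana
operator is linear in the Majorana operators, so the Heisenberg equation is a linear ODE, solved in
`exp_conj_eq_sum_of_commutator`.

For the decay, the critical kernel is a shift minus its inverse on a ring of `2V` points with twist
`-σ`. Plane waves of momenta `p` diagonalise it with eigenvalues `2i sin p`, and the entries of `exp
(2tK)` are averages of `exp i(p d + 4 t sin p)` over `2V` momenta (`exp_isingKernel_apply`). A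
discrete van der Corput argument bounds them. Successive phases differ by `c + A cos q` with `A` of
order `t / V`, which is monotone on each half period. Where the increment has modulus at least
`lam`, summation by parts gives `O(1 / lam)` (`norm_sum_le_of_phase_ge`). Since the cosine varies at
least quadratically, at most `1 + V √(lam / A)` other terms remain (`norm_sum_half_period_le`). With
`lam = π r / V` and `r = t^(1/3)` both contributions are of order `V / r` (`norm_sum_phase_le`).

The increments must avoid nonzero multiples of `2π`, which is ensured by `4πt ≤ V`. For `t ≤
V^(6/7)` this fails only when `V` and `t` are bounded by absolute constants, and then the trivial
bound suffices. -/

theorem onSite_mul_apply {V : ℕ} (j : Fin V) (A : Matrix (Fin 2) (Fin 2) ℂ) (M : Op V)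
    (s s' : Fin V → Fin 2) :
    (onSite j A * M) s s' = ∑ x, A (s j) x * M (Function.update s j x) s' := by
  rw [Matrix.mul_apply]
  symm
  refine Finset.sum_of_injOn (fun x => Function.update s j x) ?_ ?_ ?_ ?_
  · intro x _ y _ h
    simpa using congrFun h j
  · intro x _
    simp
  · intro r _ hr
    have : ¬ ∀ l, l ≠ j → s l = r l := by
      intro h
      refine hr ⟨r j, by simp, ?_⟩
      funext l
      by_cases hl : l = j
      · subst hl; simp
      · simp [hl, h l hl]
    simp only [onSite, if_neg this, zero_mul]
  · intro x _
    have : ∀ l, l ≠ j → s l = Function.update s j x l := fun l hl => by simp [hl]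
    simp only [onSite, if_pos this, Function.update_self]

theorem onSite_mul_onSite {V : ℕ} (j : Fin V) (A B : Matrix (Fin 2) (Fin 2) ℂ) :
    onSite j A * onSite j B = onSite j (A * B) := by
  ext s s'
  rw [onSite_mul_apply]
  have h : ∀ x, (∀ l, l ≠ j → Function.update s j x l = s' l) ↔ ∀ l, l ≠ j → s l = s' l := by
    intro x
    refine forall₂_congr fun l hl => ?_
    simp [hl]
  simp only [onSite, h, Function.update_self, Matrix.mul_apply]
  split_ifs <;> simp

theorem onSite_mul_onSite_apply_of_ne {V : ℕ} {i j : Fin V} (hij : i ≠ j)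
    (A B : Matrix (Fin 2) (Fin 2) ℂ) (s s' : Fin V → Fin 2) :
    (onSite i A * onSite j B) s s' =
      if ∀ l, l ≠ i → l ≠ j → s l = s' l then A (s i) (s' i) * B (s j) (s' j) else 0 := by
  rw [onSite_mul_apply, Finset.sum_eq_single (s' i)]
  · have h : (∀ l, l ≠ j → Function.update s i (s' i) l = s' l) ↔
        ∀ l, l ≠ i → l ≠ j → s l = s' l := by
      refine forall_congr' fun l => ?_
      by_cases hl : l = i
      · subst hl; simp
      · simp [hl]
    simp only [onSite, h, Function.update_of_ne hij.symm]
    split_ifs <;> simp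
  · intro x _ hx
    have : ¬ ∀ l, l ≠ j → Function.update s i x l = s' l := fun h => hx (by simpa using h i hij)
    simp only [onSite, if_neg this, mul_zero]
  · simp

theorem onSite_comm {V : ℕ} {i j : Fin V} (hij : i ≠ j) (A B : Matrix (Fin 2) (Fin 2) ℂ) :
    onSite i A * onSite j B = onSite j B * onSite i A := by
  ext s s'
  rw [onSite_mul_onSite_apply_of_ne hij, onSite_mul_onSite_apply_of_ne hij.symm]
  have h : (∀ l, l ≠ i → l ≠ j → s l = s' l) ↔ ∀ l, l ≠ j → l ≠ i → s l = s' l :=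
    forall_congr' fun l => imp.swap
  simp only [h, mul_comm]

theorem onSite_add {V : ℕ} (j : Fin V) (A B : Matrix (Fin 2) (Fin 2) ℂ) :
    onSite j (A + B) = onSite j A + onSite j B := by
  ext s s'
  simp only [onSite, Matrix.add_apply]
  split_ifs <;> simp

theorem onSite_smul {V : ℕ} (j : Fin V) (z : ℂ) (A : Matrix (Fin 2) (Fin 2) ℂ) :
    onSite j (z • A) = z • onSite j A := by
  ext s s'
  simp only [onSite, Matrix.smul_apply]
  split_ifs <;> simp

theorem onSite_neg {V : ℕ} (j : Fin V) (A : Matrix (Fin 2) (Fin 2) ℂ) :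
    onSite j (-A) = -onSite j A := by
  rw [← neg_one_smul ℂ A, onSite_smul, neg_one_smul]

theorem onSite_sub {V : ℕ} (j : Fin V) (A B : Matrix (Fin 2) (Fin 2) ℂ) :
    onSite j (A - B) = onSite j A - onSite j B := by
  rw [sub_eq_add_neg, onSite_add, onSite_neg, sub_eq_add_neg]

theorem onSite_one {V : ℕ} (j : Fin V) : onSite j (1 : Matrix (Fin 2) (Fin 2) ℂ) = 1 := by
  ext s s'
  simp only [onSite, Matrix.one_apply]
  by_cases h : s = s'
  · subst h; simp
  · rw [if_neg h]
    split_ifs with h1 h2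
    · refine absurd (funext fun l => ?_) h
      by_cases hl : l = j
      · rwa [hl]
      · exact h1 l hl
    · rfl
    · rfl

theorem onSite_conjTranspose {V : ℕ} (j : Fin V) (A : Matrix (Fin 2) (Fin 2) ℂ) :
    (onSite j A)ᴴ = onSite j Aᴴ := by
  ext s s'
  have h : (∀ l, l ≠ j → s' l = s l) ↔ ∀ l, l ≠ j → s l = s' l := by simp only [eq_comm]
  simp only [onSite, Matrix.conjTranspose_apply, h]
  split_ifs <;> simp

theorem onSite_pauliZ {V : ℕ} (j : Fin V) :
    onSite j pauliZ = Matrix.diagonal fun s => (-1 : ℂ) ^ (s j).val := by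
  ext s s'
  by_cases h : s = s'
  · subst h
    simp only [onSite, Matrix.diagonal_apply_eq, pauliZ]
    generalize s j = x
    fin_cases x <;> simp
  · rw [Matrix.diagonal_apply_ne _ h]
    simp only [onSite]
    split_ifs with h1
    · have h2 : s j ≠ s' j := by
        intro h2
        refine h (funext fun l => ?_)
        by_cases hl : l = j
        · rwa [hl]
        · exact h1 l hl
      generalize s j = x at *
      generalize s' j = y at *
      fin_cases x <;> fin_cases y <;> simp_all [pauliZ]
    · rfl

/-! ## Pauli algebra -/

theorem pauliX_mul_pauliX : pauliX * pauliX = 1 := by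
  ext i j; fin_cases i <;> fin_cases j <;> simp [pauliX, Matrix.mul_apply]

theorem pauliY_mul_pauliY : pauliY * pauliY = 1 := by
  ext i j; fin_cases i <;> fin_cases j <;> simp [pauliY, Matrix.mul_apply]

theorem pauliX_mul_pauliY : pauliX * pauliY = Complex.I • pauliZ := by
  ext i j; fin_cases i <;> fin_cases j <;> simp [pauliX, pauliY, pauliZ, Matrix.mul_apply]

theorem pauliY_mul_pauliX : pauliY * pauliX = -(Complex.I • pauliZ) := by
  ext i j; fin_cases i <;> fin_cases j <;> simp [pauliX, pauliY, pauliZ, Matrix.mul_apply]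

theorem pauliY_mul_pauliZ : pauliY * pauliZ = Complex.I • pauliX := by
  ext i j; fin_cases i <;> fin_cases j <;> simp [pauliX, pauliY, pauliZ, Matrix.mul_apply]

theorem pauliX_conjTranspose : pauliXᴴ = pauliX := by
  ext i j; fin_cases i <;> fin_cases j <;> simp [pauliX]

theorem pauliY_conjTranspose : pauliYᴴ = pauliY := by
  ext i j; fin_cases i <;> fin_cases j <;> simp [pauliY]

/-! ## Jordan–Wigner strings -/

theorem diagonal_mul_onSite_of_eq {V : ℕ} (j : Fin V) (A : Matrix (Fin 2) (Fin 2) ℂ)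
    (d : (Fin V → Fin 2) → ℂ)
    (hd : ∀ s s', (∀ l, l ≠ j → s l = s' l) → d s = d s') :
    Matrix.diagonal d * onSite j A = onSite j A * Matrix.diagonal d := by
  ext s s'
  rw [Matrix.diagonal_mul, Matrix.mul_diagonal]
  simp only [onSite]
  split_ifs with h
  · rw [hd s s' h, mul_comm]
  · simp

theorem diagonal_mul_onSite_of_eq_neg {V : ℕ} (j : Fin V) (A : Matrix (Fin 2) (Fin 2) ℂ)
    (hA : ∀ x, A x x = 0) (d : (Fin V → Fin 2) → ℂ)
    (hd : ∀ s s', (∀ l, l ≠ j → s l = s' l) → s j ≠ s' j → d s = -d s') :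
    Matrix.diagonal d * onSite j A = -(onSite j A * Matrix.diagonal d) := by
  ext s s'
  rw [Matrix.diagonal_mul, Matrix.neg_apply, Matrix.mul_diagonal]
  simp only [onSite]
  split_ifs with h
  · by_cases h2 : s j = s' j
    · rw [h2, hA]; simp
    · rw [hd s s' h h2]; ring
  · simp

theorem prod_neg_one_pow_eq_neg {V : ℕ} (F : Finset (Fin V)) {j : Fin V} (hj : j ∈ F)
    {s s' : Fin V → Fin 2} (h : ∀ l, l ≠ j → s l = s' l) (hne : s j ≠ s' j) :
    ∏ l ∈ F, (-1 : ℂ) ^ (s l).val = -∏ l ∈ F, (-1 : ℂ) ^ (s' l).val := by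
  rw [← Finset.mul_prod_erase F _ hj, ← Finset.mul_prod_erase F _ hj, ← neg_mul]
  congr 1
  · generalize s j = x at *
    generalize s' j = y at *
    fin_cases x <;> fin_cases y <;> simp_all
  · refine Finset.prod_congr rfl fun l hl => ?_
    rw [h l (Finset.ne_of_mem_erase hl)]

theorem jwString_mul_onSite_of_le {V : ℕ} {i j : Fin V} (hij : i ≤ j)
    (A : Matrix (Fin 2) (Fin 2) ℂ) : jwString i * onSite j A = onSite j A * jwString i := by
  refine diagonal_mul_onSite_of_eq j A _ fun s s' h => Finset.prod_congr rfl fun l hl => ?_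
  rw [h l]
  rw [Finset.mem_filter] at hl
  exact (lt_of_lt_of_le hl.2 hij).ne

theorem jwString_mul_onSite_of_lt {V : ℕ} {i j : Fin V} (hij : j < i)
    (A : Matrix (Fin 2) (Fin 2) ℂ) (hA : ∀ x, A x x = 0) :
    jwString i * onSite j A = -(onSite j A * jwString i) :=
  diagonal_mul_onSite_of_eq_neg j A hA _ fun _ _ h hne =>
    prod_neg_one_pow_eq_neg _ (by simpa using hij) h hne

theorem parityOp_mul_onSite {V : ℕ} (j : Fin V)
    (A : Matrix (Fin 2) (Fin 2) ℂ) (hA : ∀ x, A x x = 0) :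
    parityOp V * onSite j A = -(onSite j A * parityOp V) :=
  diagonal_mul_onSite_of_eq_neg j A hA _ fun _ _ h hne =>
    prod_neg_one_pow_eq_neg _ (Finset.mem_univ j) h hne

theorem jwString_mul_self {V : ℕ} (j : Fin V) : jwString j * jwString j = 1 := by
  rw [jwString, Matrix.diagonal_mul_diagonal, ← Matrix.diagonal_one]
  congr 1
  funext s
  rw [← Finset.prod_mul_distrib]
  refine Finset.prod_eq_one fun l _ => ?_
  rw [← mul_pow]; simp

theorem jwString_comm {V : ℕ} (i j : Fin V) : jwString i * jwString j = jwString j * jwString i := by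
  rw [jwString, jwString, Matrix.diagonal_mul_diagonal, Matrix.diagonal_mul_diagonal]
  simp only [mul_comm]

theorem jwString_conjTranspose {V : ℕ} (j : Fin V) : (jwString j)ᴴ = jwString j := by
  rw [jwString, Matrix.diagonal_conjTranspose]
  congr 1
  funext s
  simp [star_prod]

theorem jwString_zero {n : ℕ} : jwString (0 : Fin (n + 1)) = 1 := by
  simp [jwString]

theorem jwString_succ {n : ℕ} (i : Fin n) :
    jwString i.succ = jwString i.castSucc * onSite i.castSucc pauliZ := by
  rw [onSite_pauliZ, jwString, jwString, Matrix.diagonal_mul_diagonal]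
  congr 1
  funext s
  have : Finset.univ.filter (fun l => l < i.succ) =
      insert i.castSucc (Finset.univ.filter (fun l => l < i.castSucc)) := by
    ext l
    simp [Fin.lt_def, Fin.ext_iff]
    omega
  rw [this, Finset.prod_insert (by simp), mul_comm]

theorem parityOp_succ (n : ℕ) :
    parityOp (n + 1) = jwString (Fin.last n) * onSite (Fin.last n) pauliZ := by
  rw [onSite_pauliZ, jwString, parityOp, Matrix.diagonal_mul_diagonal]
  congr 1
  funext s
  have : (Finset.univ : Finset (Fin (n + 1))) =
      insert (Fin.last n) (Finset.univ.filter (fun l => l < Fin.last n)) := by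
    ext l
    simp [Fin.lt_def, Fin.ext_iff]
    omega
  conv_lhs => rw [this, Finset.prod_insert (by simp), mul_comm]

/-! ## Majorana operators -/

/-- The Pauli matrix of the Majorana operator at position `μ` inside a site. -/
def majoranaPauli (μ : Fin 2) : Matrix (Fin 2) (Fin 2) ℂ := if μ = 0 then pauliX else pauliY

theorem majoranaPauli_diag (μ x : Fin 2) : majoranaPauli μ x x = 0 := by
  fin_cases μ <;> fin_cases x <;> simp [majoranaPauli, pauliX, pauliY]

theorem majoranaPauli_anticomm (μ ν : Fin 2) :
    majoranaPauli μ * majoranaPauli ν + majoranaPauli ν * majoranaPauli μ =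
      if μ = ν then 2 else 0 := by
  fin_cases μ <;> fin_cases ν <;>
    simp [majoranaPauli, pauliX_mul_pauliX, pauliY_mul_pauliY, pauliX_mul_pauliY,
      pauliY_mul_pauliX, one_add_one_eq_two]

theorem annihilation_conjTranspose {V : ℕ} (j : Fin V) :
    (annihilation j)ᴴ = jwString j * onSite j ((1 / 2 : ℂ) • (pauliX - Complex.I • pauliY)) := by
  rw [annihilation, Matrix.conjTranspose_mul, onSite_conjTranspose, jwString_conjTranspose,
    ← jwString_mul_onSite_of_le le_rfl, Matrix.conjTranspose_smul, Matrix.conjTranspose_add,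
    Matrix.conjTranspose_smul, pauliX_conjTranspose, pauliY_conjTranspose]
  simp [sub_eq_add_neg]

theorem majorana_eq {V : ℕ} (a : Fin (V * 2)) :
    majorana a = ((Real.sqrt 2 : ℂ))⁻¹ •
      (jwString a.divNat * onSite a.divNat (majoranaPauli a.modNat)) := by
  rw [majorana, majoranaPauli, annihilation_conjTranspose, annihilation, ← mul_add, ← mul_sub,
    ← onSite_add, ← onSite_sub, ← smul_add, ← smul_sub]
  have h1 : (1 / 2 : ℂ) • (pauliX - Complex.I • pauliY + (pauliX + Complex.I • pauliY)) =
      pauliX := by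
    module
  have h2 : (1 / 2 : ℂ) • (pauliX - Complex.I • pauliY - (pauliX + Complex.I • pauliY)) =
      -Complex.I • pauliY := by
    module
  rw [h1, h2]
  split_ifs
  · rfl
  · rw [onSite_smul, mul_smul_comm, smul_smul]
    congr 1
    linear_combination (-(Real.sqrt 2 : ℂ)⁻¹) * Complex.I_mul_I

theorem jw_mul_jw_self {V : ℕ} (j : Fin V) (A B : Matrix (Fin 2) (Fin 2) ℂ) :
    (jwString j * onSite j A) * (jwString j * onSite j B) = onSite j (A * B) := by
  rw [jwString_mul_onSite_of_le le_rfl A, mul_assoc, ← mul_assoc (jwString j), jwString_mul_self,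
    one_mul, onSite_mul_onSite]

/-- Of all the exchanges, only moving the operator at site `i` through the string of the later site
`j` costs a sign. -/
theorem jw_anticomm_of_lt {V : ℕ} {i j : Fin V} (hij : i < j) (A B : Matrix (Fin 2) (Fin 2) ℂ)
    (hA : ∀ x, A x x = 0) :
    (jwString i * onSite i A) * (jwString j * onSite j B) =
      -((jwString j * onSite j B) * (jwString i * onSite i A)) := by
  have h1 : (jwString i * onSite i A) * (jwString j * onSite j B) =
      jwString i * (onSite i A * jwString j) * onSite j B := by simp only [mul_assoc]
  have h2 : (jwString j * onSite j B) * (jwString i * onSite i A) =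
      jwString j * (onSite j B * jwString i) * onSite i A := by simp only [mul_assoc]
  rw [h1, h2, ← neg_eq_iff_eq_neg.mpr (jwString_mul_onSite_of_lt hij A hA),
    ← jwString_mul_onSite_of_le hij.le B]
  rw [mul_neg, neg_mul, mul_assoc, mul_assoc, mul_assoc, mul_assoc, onSite_comm hij.ne,
    ← mul_assoc, ← mul_assoc (jwString j), jwString_comm i j]

theorem two_smul_one :
    (2 : Matrix (Fin 2) (Fin 2) ℂ) = (2 : ℂ) • (1 : Matrix (Fin 2) (Fin 2) ℂ) := by
  rw [two_smul, one_add_one_eq_two]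

theorem inv_sqrt_two_mul_self : ((Real.sqrt 2 : ℂ))⁻¹ * ((Real.sqrt 2 : ℂ))⁻¹ = 1 / 2 := by
  rw [← mul_inv, ← Complex.ofReal_mul, Real.mul_self_sqrt (by norm_num)]
  norm_num

theorem majorana_anticomm {V : ℕ} (a b : Fin (V * 2)) :
    majorana a * majorana b + majorana b * majorana a = if a = b then 1 else 0 := by
  have hab : a = b ↔ a.divNat = b.divNat ∧ a.modNat = b.modNat := by
    constructor
    · rintro rfl; simp
    · rintro ⟨h1, h2⟩
      exact finProdFinEquiv.symm.injective (Prod.ext h1 h2)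
  simp only [majorana_eq, smul_mul_smul_comm, inv_sqrt_two_mul_self]
  rw [← smul_add]
  rcases lt_trichotomy a.divNat b.divNat with h | h | h
  · rw [jw_anticomm_of_lt h _ _ (majoranaPauli_diag _), if_neg (fun h' => h.ne (hab.1 h').1)]
    simp
  · rw [h, jw_mul_jw_self, jw_mul_jw_self, ← onSite_add, majoranaPauli_anticomm]
    by_cases h' : a.modNat = b.modNat
    · rw [if_pos h', if_pos (hab.2 ⟨h, h'⟩), two_smul_one, onSite_smul, onSite_one]
      module
    · rw [if_neg h', if_neg (fun h'' => h' (hab.1 h'').2), ← zero_smul ℂ (1 : Matrix _ _ ℂ),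
        onSite_smul]
      simp
  · rw [jw_anticomm_of_lt h _ _ (majoranaPauli_diag _), if_neg (fun h' => h.ne' (hab.1 h').1)]
    simp

/-! ## The sector Hamiltonian -/

/-- The Majorana index of position `μ` inside site `j`. -/
abbrev siteIndex {V : ℕ} (j : Fin V) (μ : Fin 2) : Fin (V * 2) := finProdFinEquiv (j, μ)

theorem siteIndex_divNat {V : ℕ} (j : Fin V) (μ : Fin 2) : (siteIndex j μ).divNat = j :=
  congrArg Prod.fst (finProdFinEquiv.symm_apply_apply (j, μ))

theorem siteIndex_modNat {V : ℕ} (j : Fin V) (μ : Fin 2) : (siteIndex j μ).modNat = μ :=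
  congrArg Prod.snd (finProdFinEquiv.symm_apply_apply (j, μ))

theorem siteIndex_val {V : ℕ} (j : Fin V) (μ : Fin 2) :
    (siteIndex j μ).val = μ.val + 2 * j.val := rfl

theorem sum_siteIndex {V : ℕ} {M : Type*} [AddCommMonoid M] (F : Fin (V * 2) → M) :
    ∑ a, F a = ∑ j : Fin V, (F (siteIndex j 0) + F (siteIndex j 1)) := by
  rw [← (finProdFinEquiv (m := V) (n := 2)).sum_comp, Fintype.sum_prod_type]
  simp only [Fin.sum_univ_two]

/-- Neighbouring Majorana indices lie either inside one site (weight `g`) or on two consecutive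
sites (weight `1`). The corner is kept as a separate summand, so that a one-site chain, where it
coincides with a neighbour entry, needs no special case. -/
theorem sum_isingUpper {n : ℕ} (g σ : ℝ) {M : Type*} [AddCommGroup M] [Module ℂ M]
    (F : Fin ((n + 1) * 2) → Fin ((n + 1) * 2) → M) :
    ∑ a, ∑ b, (isingUpper (n + 1) g σ a b : ℂ) • F a b =
      (g : ℂ) • (∑ j, F (siteIndex j 0) (siteIndex j 1))
        + ∑ i : Fin n, F (siteIndex i.castSucc 1) (siteIndex i.succ 0)
        + (σ : ℂ) • F (siteIndex 0 0) (siteIndex (Fin.last n) 1) := by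
  have hcorner : ∀ a b : Fin ((n + 1) * 2), (a.val = 0 ∧ b.val + 1 = (n + 1) * 2) ↔
      (a = siteIndex 0 0 ∧ b = siteIndex (Fin.last n) 1) := by
    intro a b
    simp only [Fin.ext_iff, siteIndex_val, Fin.val_zero, Fin.val_last, Fin.val_one]
    omega
  simp only [isingUpper, Complex.ofReal_add, add_smul, Finset.sum_add_distrib]
  congr 1
  · rw [sum_siteIndex]
    simp only [sum_siteIndex (fun b => _ • F _ b), siteIndex_val, siteIndex_modNat,
      Fin.val_zero, Fin.val_one]
    have h1 : ∀ j k : Fin (n + 1), (0 + 2 * j.val + 1 = 0 + 2 * k.val) ↔ False := by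
      intro j k; rw [iff_false]; omega
    have h2 : ∀ j k : Fin (n + 1), (0 + 2 * j.val + 1 = 1 + 2 * k.val) ↔ j = k := by
      intro j k; rw [Fin.ext_iff]; constructor <;> intro h <;> omega
    have h3 : ∀ j k : Fin (n + 1), (1 + 2 * j.val + 1 = 1 + 2 * k.val) ↔ False := by
      intro j k; rw [iff_false]; omega
    have h4 : ∀ j k : Fin (n + 1), (1 + 2 * j.val + 1 = 0 + 2 * k.val) ↔ j.val + 1 = k.val := by
      intro j k; constructor <;> intro h <;> omega
    simp only [h1, h2, h3, h4]
    rw [Finset.sum_add_distrib]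
    congr 1
    · rw [Finset.smul_sum]
      refine Finset.sum_congr rfl fun j _ => ?_
      rw [Finset.sum_eq_single j]
      · simp
      · intro k _ hk
        simp [hk.symm]
      · simp
    · rw [Fin.sum_univ_castSucc]
      have hlast : ∀ k : Fin (n + 1), ((Fin.last n).val + 1 = k.val) ↔ False := by
        intro k; rw [Fin.val_last, iff_false]; omega
      simp only [hlast]
      simp only [if_false, Complex.ofReal_zero, zero_smul, add_zero, Finset.sum_const_zero]
      refine Finset.sum_congr rfl fun i _ => ?_
      rw [Finset.sum_eq_single i.succ]
      · simp
      · intro k _ hk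
        have : ¬ (i.castSucc.val + 1 = k.val) := fun h => hk (Fin.ext (by simpa using h.symm))
        rw [if_neg this]; simp
      · simp
  · simp only [hcorner]
    rw [Finset.sum_eq_single (siteIndex 0 0), Finset.sum_eq_single (siteIndex (Fin.last n) 1)]
    · simp
    · intro b _ hb
      simp [hb]
    · simp
    · intro a _ ha
      simp [ha]
    · simp

theorem sum_isingKernel {V : ℕ} (g σ : ℝ) :
    ∑ a : Fin (V * 2), ∑ b : Fin (V * 2),
      (isingKernel V g σ a b : ℂ) • (majorana a * majorana b) =
    ∑ a : Fin (V * 2), ∑ b : Fin (V * 2), (isingUpper V g σ a b : ℂ) •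
      (majorana a * majorana b - majorana b * majorana a) := by
  simp only [isingKernel, Matrix.sub_apply, Matrix.transpose_apply, Complex.ofReal_sub, sub_smul,
    smul_sub, Finset.sum_sub_distrib]
  congr 1
  exact Finset.sum_comm

/-- Distinct Majorana operators anticommute, so their commutator is twice their product; this 2
cancels the two normalisations `1 / √2`. Different positions `μ ≠ ν` keep the indices distinct even
on the same site. -/
theorem commutator_majorana {V : ℕ} (i j : Fin V) {μ ν : Fin 2} (h : μ ≠ ν) :
    majorana (siteIndex i μ) * majorana (siteIndex j ν)
        - majorana (siteIndex j ν) * majorana (siteIndex i μ) =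
      (jwString i * onSite i (majoranaPauli μ)) * (jwString j * onSite j (majoranaPauli ν)) := by
  have hne : siteIndex i μ ≠ siteIndex j ν := fun h' => h (by
    rw [← siteIndex_modNat i μ, h', siteIndex_modNat])
  have h0 := majorana_anticomm (siteIndex i μ) (siteIndex j ν)
  rw [if_neg hne] at h0
  rw [eq_neg_of_add_eq_zero_right h0, sub_neg_eq_add, majorana_eq, majorana_eq,
    siteIndex_divNat, siteIndex_divNat, siteIndex_modNat, siteIndex_modNat,
    smul_mul_smul_comm, inv_sqrt_two_mul_self, ← add_smul]
  norm_num

theorem sectorHamiltonian_succ (n : ℕ) (g σ : ℝ) :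
    sectorHamiltonian (n + 1) g σ =
      -((g : ℂ) • ∑ j, onSite j pauliZ)
        - ∑ i : Fin n, onSite i.castSucc pauliX * onSite i.succ pauliX
        - (σ : ℂ) • (onSite 0 pauliX * onSite (Fin.last n) pauliX * parityOp (n + 1)) := by
  rw [sectorHamiltonian, sum_isingKernel, sum_isingUpper]
  have h1 : ∀ j : Fin (n + 1), (jwString j * onSite j (majoranaPauli 0)) *
      (jwString j * onSite j (majoranaPauli 1)) = Complex.I • onSite j pauliZ := by
    intro j
    rw [jw_mul_jw_self, ← onSite_smul, ← pauliX_mul_pauliY]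
    rfl
  have h2 : ∀ i : Fin n, (jwString i.castSucc * onSite i.castSucc (majoranaPauli 1)) *
      (jwString i.succ * onSite i.succ (majoranaPauli 0)) =
        Complex.I • (onSite i.castSucc pauliX * onSite i.succ pauliX) := by
    intro i
    rw [jwString_succ, ← mul_assoc, jw_mul_jw_self, ← smul_mul_assoc, ← onSite_smul,
      ← pauliY_mul_pauliZ]
    rfl
  -- Writing `Y = -i Z X` completes the string of the last site to the full parity operator; moving
  -- that past `X` at the last site gives a sign.
  have h3 : (jwString 0 * onSite 0 (majoranaPauli 0)) *
      (jwString (Fin.last n) * onSite (Fin.last n) (majoranaPauli 1)) =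
        Complex.I • (onSite 0 pauliX * onSite (Fin.last n) pauliX * parityOp (n + 1)) := by
    have hX : ∀ x, pauliX x x = 0 := majoranaPauli_diag 0
    have hY : majoranaPauli 1 = -Complex.I • (pauliZ * pauliX) := by
      ext i j
      fin_cases i <;> fin_cases j <;>
        simp [majoranaPauli, pauliX, pauliY, pauliZ]
    rw [hY, onSite_smul, ← onSite_mul_onSite, mul_smul_comm, ← mul_assoc (jwString (Fin.last n)),
      ← parityOp_succ, parityOp_mul_onSite _ _ hX, jwString_zero, one_mul, mul_smul_comm, mul_neg,
      neg_smul, smul_neg, neg_neg, mul_assoc]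
    rfl
  rw [Finset.sum_congr rfl fun j _ => (commutator_majorana j j zero_ne_one).trans (h1 j),
    Finset.sum_congr rfl fun i _ =>
      (commutator_majorana (Fin.castSucc i) (Fin.succ i) one_ne_zero).trans (h2 i),
    (commutator_majorana 0 (Fin.last n) zero_ne_one).trans h3]
  simp only [← Finset.smul_sum, smul_add, smul_smul]
  have e1 : Complex.I * ((g : ℂ) * Complex.I) = -g := by
    linear_combination (g : ℂ) * Complex.I_mul_I
  have e2 : Complex.I * ((σ : ℂ) * Complex.I) = -σ := by
    linear_combination (σ : ℂ) * Complex.I_mul_I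
  rw [e1, e2, Complex.I_mul_I]
  module

theorem isingHamiltonian_succ (n : ℕ) (g : ℝ) :
    isingHamiltonian (n + 1) g =
      -((g : ℂ) • ∑ j, onSite j pauliZ)
        - ∑ i : Fin n, onSite i.castSucc pauliX * onSite i.succ pauliX
        - onSite 0 pauliX * onSite (Fin.last n) pauliX := by
  have h : onSite (Fin.last n) pauliX * onSite 0 pauliX =
      onSite 0 pauliX * onSite (Fin.last n) pauliX := by
    by_cases h : Fin.last n = 0
    · rw [h]
    · exact onSite_comm h _ _
  rw [isingHamiltonian, Fin.sum_univ_castSucc, finRotate_last, h]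
  simp only [finRotate_apply, Fin.coeSucc_eq_succ]
  abel

theorem isingHamiltonian_mulVec_eq {V : ℕ} (hV : 1 ≤ V) (g : ℝ) {σ : ℝ} (hσ : σ * σ = 1)
    (ψ : (Fin V → Fin 2) → ℂ) (hψ : parityOp V *ᵥ ψ = (σ : ℂ) • ψ) :
    isingHamiltonian V g *ᵥ ψ = sectorHamiltonian V g σ *ᵥ ψ := by
  obtain ⟨n, rfl⟩ := Nat.exists_eq_add_of_le' hV
  rw [isingHamiltonian_succ, sectorHamiltonian_succ, Matrix.sub_mulVec, Matrix.sub_mulVec _ (_ • _),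
    Matrix.smul_mulVec, ← Matrix.mulVec_mulVec ψ (_ * _) (parityOp _), hψ, Matrix.mulVec_smul,
    smul_smul, ← Complex.ofReal_mul, hσ]
  simp

/-! ## Commutators with the sector Hamiltonian -/

/-- This is the identity `[bc, a] = b{c, a} - {a, b}c`, which makes commutators with quadratic
operators linear. -/
theorem commutator_mul_majorana {V : ℕ} (a b c : Fin (V * 2)) :
    (majorana b * majorana c) * majorana a - majorana a * (majorana b * majorana c) =
      (if c = a then majorana b else 0) - (if a = b then majorana c else 0) := by
  have h1 := majorana_anticomm c a
  have h2 := majorana_anticomm a b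
  have : (majorana b * majorana c) * majorana a - majorana a * (majorana b * majorana c) =
      majorana b * (majorana c * majorana a + majorana a * majorana c)
        - (majorana a * majorana b + majorana b * majorana a) * majorana c := by
    noncomm_ring
  rw [this, h1, h2]
  split_ifs <;> simp

theorem isingKernel_antisymm {V : ℕ} (g σ : ℝ) (a b : Fin (V * 2)) :
    isingKernel V g σ b a = -isingKernel V g σ a b := by
  simp [isingKernel]

theorem sectorHamiltonian_commutator_majorana {V : ℕ} (g σ : ℝ) (a : Fin (V * 2)) :
    sectorHamiltonian V g σ * majorana a - majorana a * sectorHamiltonian V g σ =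
      ∑ b, (-2 * Complex.I * (isingKernel V g σ a b : ℂ)) • majorana b := by
  have h : sectorHamiltonian V g σ * majorana a - majorana a * sectorHamiltonian V g σ =
      Complex.I • ∑ b, ∑ c, (isingKernel V g σ b c : ℂ) •
        ((if c = a then majorana b else 0) - (if a = b then majorana c else 0)) := by
    simp only [← commutator_mul_majorana, smul_sub, Finset.sum_sub_distrib, sectorHamiltonian,
      smul_mul_assoc, mul_smul_comm, Finset.sum_mul, Finset.mul_sum]
  rw [h]
  simp only [smul_sub, Finset.sum_sub_distrib, smul_ite, smul_zero, Finset.sum_ite_eq',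
    Finset.mem_univ, if_true]
  rw [Finset.sum_comm (f := fun b c => if a = b then (isingKernel V g σ b c : ℂ) • majorana c else 0)]
  simp only [Finset.sum_ite_eq, Finset.mem_univ, if_true]
  rw [Finset.smul_sum, Finset.smul_sum, ← Finset.sum_sub_distrib]
  refine Finset.sum_congr rfl fun b _ => ?_
  rw [isingKernel_antisymm g σ a b]
  push_cast
  module

/-! ## Heisenberg evolution of a vector of operators closed under commutators -/

section Heisenberg

attribute [local instance] Matrix.linftyOpNormedRing Matrix.linftyOpNormedAlgebra

theorem hasDerivAt_exp_smul_apply {ι : Type*} [Fintype ι] [DecidableEq ι] (L : Matrix ι ι ℂ)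
    (a b : ι) (s : ℝ) :
    HasDerivAt (fun u : ℝ => NormedSpace.exp (u • L) a b) ((NormedSpace.exp (s • L) * L) a b) s :=
  ((Matrix.entryLinearMap ℝ ℂ a b).toContinuousLinearMap.hasFDerivAt).comp_hasDerivAt s
    (hasDerivAt_exp_smul_const L s)

theorem exp_mul_exp_neg {ι : Type*} [Fintype ι] [DecidableEq ι] (X : Matrix ι ι ℂ) :
    NormedSpace.exp X * NormedSpace.exp (-X) = 1 := by
  rw [← Matrix.exp_add_of_commute _ _ (Commute.refl X).neg_right, add_neg_cancel,
    NormedSpace.exp_zero]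

/-- Both sides solve the same linear ODE: `B(s) = ∑ b, (exp sL) a b • A b` satisfies `B' = [X, B]`,
so undoing the conjugation by `exp (sX)` leaves a constant `G`, compared at `0` and `1`. -/
theorem exp_conj_eq_sum_of_commutator {n ι : Type*} [Fintype n] [DecidableEq n] [Fintype ι]
    [DecidableEq ι] (X : Matrix n n ℂ) (L : Matrix ι ι ℂ) (A : ι → Matrix n n ℂ)
    (h : ∀ a, X * A a - A a * X = ∑ b, L a b • A b) (a : ι) :
    NormedSpace.exp X * A a * NormedSpace.exp (-X) = ∑ b, NormedSpace.exp L a b • A b := by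
  set B : ℝ → Matrix n n ℂ := fun s => ∑ b, NormedSpace.exp (s • L) a b • A b with hB
  set G : ℝ → Matrix n n ℂ := fun s =>
    NormedSpace.exp (s • -X) * B s * NormedSpace.exp (s • X) with hG
  have hBd : ∀ s, HasDerivAt B (X * B s - B s * X) s := by
    intro s
    have h1 : HasDerivAt B (∑ b, (NormedSpace.exp (s • L) * L) a b • A b) s := by
      rw [hB]
      exact HasDerivAt.fun_sum fun b _ => (hasDerivAt_exp_smul_apply L a b s).smul_const (A b)
    have h2 : X * B s - B s * X = ∑ b, (NormedSpace.exp (s • L) * L) a b • A b := by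
      simp only [hB, Finset.mul_sum, Finset.sum_mul, mul_smul_comm, smul_mul_assoc,
        ← Finset.sum_sub_distrib, ← smul_sub, h, Finset.smul_sum, Matrix.mul_apply,
        Finset.sum_smul, smul_smul]
      exact Finset.sum_comm
    rwa [h2]
  have hGd : ∀ s, HasDerivAt G 0 s := by
    intro s
    have h1 := ((hasDerivAt_exp_smul_const (-X) s).mul (hBd s)).mul
      (hasDerivAt_exp_smul_const' X s)
    refine HasDerivAt.congr_deriv (f := G) h1 ?_
    simp only [Pi.mul_apply]
    noncomm_ring
  have hconst : G 1 = G 0 :=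
    is_const_of_deriv_eq_zero (fun s => (hGd s).differentiableAt) (fun s => (hGd s).deriv) 1 0
  have h0 : G 0 = A a := by
    simp [hG, hB, NormedSpace.exp_zero, Matrix.one_apply]
  have h1 : G 1 = NormedSpace.exp (-X) * (∑ b, NormedSpace.exp L a b • A b) *
      NormedSpace.exp X := by
    simp [hG, hB]
  have h3 := exp_mul_exp_neg X
  rw [← h0, ← hconst, h1, ← mul_assoc, ← mul_assoc, h3, one_mul, mul_assoc, h3, mul_one]

end Heisenberg

/-! ## The change of basis between the Majorana operators and the fermions -/

theorem omega_siteIndex {V : ℕ} (j k : Fin V) (μ ν : Fin 2) :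
    omega V (siteIndex j μ) (siteIndex k ν) = if j = k then
      ((Real.sqrt 2 : ℂ))⁻¹ * !![(1 : ℂ), 1; -Complex.I, Complex.I] μ ν else 0 := by
  rw [omega, siteIndex_divNat, siteIndex_divNat, siteIndex_modNat, siteIndex_modNat]

theorem exists_siteIndex {V : ℕ} (a : Fin (V * 2)) : ∃ j μ, siteIndex j μ = a :=
  ⟨a.divNat, a.modNat, finProdFinEquiv.apply_symm_apply a⟩

theorem omega_mul_conjTranspose (V : ℕ) : omega V * (omega V)ᴴ = 1 := by
  ext a b
  obtain ⟨j, μ, rfl⟩ := exists_siteIndex a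
  obtain ⟨k, ν, rfl⟩ := exists_siteIndex b
  rw [Matrix.mul_apply, sum_siteIndex]
  simp only [Matrix.conjTranspose_apply, omega_siteIndex]
  rw [Finset.sum_eq_single j]
  · by_cases h : j = k
    · subst h
      have h2 := inv_sqrt_two_mul_self
      have h3 := Complex.I_mul_I
      fin_cases μ <;> fin_cases ν <;> simp <;>
      first
      | linear_combination 2 * h2
      | linear_combination 2 * h2 - 2 * ((Real.sqrt 2 : ℂ))⁻¹ ^ 2 * h3
    · have : k ≠ j := fun h' => h h'.symm
      simp [h, this]
  · intro i _ hi
    simp [hi.symm]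
  · simp

theorem conjTranspose_mul_omega (V : ℕ) : (omega V)ᴴ * omega V = 1 :=
  mul_eq_one_comm.mp (omega_mul_conjTranspose V)

theorem majorana_eq_sum {V : ℕ} (a : Fin (V * 2)) : majorana a = ∑ b, omega V a b • cOp b := by
  obtain ⟨j, μ, rfl⟩ := exists_siteIndex a
  rw [sum_siteIndex, Finset.sum_eq_single j]
  · simp only [omega_siteIndex, majorana, cOp, siteIndex_divNat, siteIndex_modNat]
    fin_cases μ
    · simp
      abel
    · simp
      module
  · intro i _ hi
    simp [omega_siteIndex, hi.symm]
  · simp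

theorem cOp_eq_sum {V : ℕ} (a : Fin (V * 2)) : cOp a = ∑ b, (omega V)ᴴ a b • majorana b := by
  simp only [majorana_eq_sum, Finset.smul_sum, smul_smul]
  rw [Finset.sum_comm]
  simp only [← Finset.sum_smul, ← Matrix.mul_apply, conjTranspose_mul_omega, Matrix.one_apply,
    ite_smul, one_smul, zero_smul, Finset.sum_ite_eq, Finset.mem_univ, if_true]

theorem sectorHamiltonian_commutator_cOp {V : ℕ} (g σ : ℝ) (a : Fin (V * 2)) :
    sectorHamiltonian V g σ * cOp a - cOp a * sectorHamiltonian V g σ =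
      ∑ b, ((-2 : ℂ) • coupling V g σ) a b • cOp b := by
  rw [cOp_eq_sum, Finset.mul_sum, Finset.sum_mul, ← Finset.sum_sub_distrib]
  simp only [mul_smul_comm, smul_mul_assoc, ← smul_sub, sectorHamiltonian_commutator_majorana]
  simp only [majorana_eq_sum, Finset.smul_sum, smul_smul, coupling, Matrix.smul_apply,
    Matrix.mul_apply, Finset.sum_smul, Finset.mul_sum, Finset.sum_mul, Matrix.map_apply,
    smul_eq_mul]
  rw [Finset.sum_comm, Finset.sum_congr rfl fun _ _ => Finset.sum_comm, Finset.sum_comm]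
  refine Finset.sum_congr rfl fun b _ => Finset.sum_congr rfl fun c _ =>
    Finset.sum_congr rfl fun d _ => ?_
  congr 1
  ring

theorem heisenberg_cOp {V : ℕ} (g σ t : ℝ) (a : Fin (V * 2)) :
    heisenberg (sectorHamiltonian V g σ) (cOp a) t =
      ∑ b, propagator V g σ t a b • cOp b := by
  rw [heisenberg, propagator, neg_mul, neg_smul]
  refine exp_conj_eq_sum_of_commutator _ _ _ (fun c => ?_) a
  rw [smul_mul_assoc, mul_smul_comm, ← smul_sub, sectorHamiltonian_commutator_cOp,
    Finset.smul_sum]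
  refine Finset.sum_congr rfl fun b _ => ?_
  simp only [Matrix.smul_apply, smul_smul, smul_eq_mul]
  congr 1
  ring

/-! ## Diagonalisation of the kernel by plane waves -/

theorem propagator_eq (V : ℕ) (g σ t : ℝ) :
    propagator V g σ t = (omega V)ᴴ *
      NormedSpace.exp ((2 * t : ℂ) • (isingKernel V g σ).map (fun x : ℝ => (x : ℂ))) *
        omega V := by
  have hinv : (omega V)⁻¹ = (omega V)ᴴ := Matrix.inv_eq_left_inv (conjTranspose_mul_omega V)
  have hunit : IsUnit (omega V) := IsUnit.of_mul_eq_one _ (omega_mul_conjTranspose V)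
  rw [propagator, ← hinv, ← Matrix.exp_conj' _ _ hunit, hinv, coupling, smul_smul, mul_smul_comm,
    smul_mul_assoc]
  congr 2
  linear_combination (-2 * (t : ℂ)) * Complex.I_mul_I

/-- At `g = 1` the kernel is invariant under translation by a single Majorana index, up to the sign
at the corner. The condition `z ^ (2V) = -σ` makes the corner entries continue the geometric
sequence around the ring. -/
theorem isingKernel_mulVec_pow {V : ℕ} (hV : 1 ≤ V) {σ : ℝ} (hσ : σ * σ = 1) {z : ℂ}
    (hz : z ≠ 0) (hzσ : z ^ (V * 2) = -σ) (a : Fin (V * 2)) :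
    ∑ b : Fin (V * 2), (isingKernel V 1 σ a b : ℂ) * z ^ b.val = (z - z⁻¹) * z ^ a.val := by
  have hσ' : (σ : ℂ) * σ = 1 := by exact_mod_cast hσ
  -- The kernel is split into a forward and a backward twisted shift; in each, every row has exactly
  -- one nonzero entry, even for `V = 1`, where the entries of the two shifts overlap.
  have h1 : ∑ b : Fin (V * 2), ((if a.val + 1 = b.val then (1 : ℂ) else 0)
      - (if b.val = 0 ∧ a.val + 1 = V * 2 then (σ : ℂ) else 0)) * z ^ b.val = z * z ^ a.val := by
    by_cases ha : a.val + 1 = V * 2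
    · rw [Finset.sum_eq_single ⟨0, by omega⟩]
      · simp only [ha, and_self, if_true]
        rw [if_neg (by omega), pow_zero, mul_one, zero_sub, ← hzσ, ← pow_succ', ha]
      · intro b _ hb
        have hb0 : b.val ≠ 0 := fun h => hb (Fin.ext h)
        have := b.isLt
        rw [if_neg (by omega), if_neg (by omega)]
        simp
      · simp
    · have ha' : a.val + 1 < V * 2 := by have := a.isLt; omega
      rw [Finset.sum_eq_single ⟨a.val + 1, ha'⟩]
      · simp only [ha, and_false, if_false, if_true]
        rw [pow_succ']; ring
      · intro b _ hb
        have : ¬ a.val + 1 = b.val := fun h => hb (Fin.ext h.symm)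
        rw [if_neg this, if_neg (by omega)]
        simp
      · simp
  have h2 : ∑ b : Fin (V * 2), ((if b.val + 1 = a.val then (1 : ℂ) else 0)
      - (if a.val = 0 ∧ b.val + 1 = V * 2 then (σ : ℂ) else 0)) * z ^ b.val =
        z⁻¹ * z ^ a.val := by
    by_cases ha : a.val = 0
    · rw [Finset.sum_eq_single ⟨V * 2 - 1, by omega⟩]
      · have e : V * 2 - 1 + 1 = V * 2 := by omega
        simp only [ha, e, and_self, if_true]
        rw [if_neg (by omega), pow_zero, mul_one, zero_sub]
        apply mul_right_cancel₀ hz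
        rw [inv_mul_cancel₀ hz, mul_assoc, ← pow_succ, e, hzσ]
        linear_combination hσ'
      · intro b _ hb
        have hb0 : b.val ≠ V * 2 - 1 := fun h => hb (Fin.ext h)
        rw [if_neg (by omega), if_neg (by omega)]
        simp
      · simp
    · rw [Finset.sum_eq_single ⟨a.val - 1, by omega⟩]
      · have e : a.val - 1 + 1 = a.val := by omega
        simp only [e, ha, false_and, if_false, if_true]
        apply mul_left_cancel₀ hz
        rw [mul_inv_cancel_left₀ hz, sub_zero, one_mul, ← pow_succ', e]
      · intro b _ hb
        have : ¬ b.val = a.val - 1 := fun h => hb (Fin.ext h)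
        rw [if_neg (by omega), if_neg (by omega)]
        simp
      · simp
  rw [sub_mul, ← h1, ← h2, ← Finset.sum_sub_distrib]
  refine Finset.sum_congr rfl fun b _ => ?_
  rw [← sub_mul]
  congr 1
  simp only [isingKernel, isingUpper, Matrix.sub_apply, Matrix.transpose_apply, ite_self]
  split_ifs <;> push_cast <;> ring

/-- The momenta `π (k + s) / V`. -/
def momentum (V : ℕ) (s : ℝ) (k : ℕ) : ℝ := Real.pi / V * (k + s)

/-- The matrix of plane waves. -/
def planeWave (V : ℕ) (s : ℝ) : Matrix (Fin (V * 2)) (Fin (V * 2)) ℂ :=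
  fun a k => Complex.exp (Complex.I * momentum V s k.val) ^ a.val

theorem isingKernel_mul_planeWave {V : ℕ} (hV : 1 ≤ V) {σ s : ℝ} (hσ : σ * σ = 1)
    (hs : Complex.exp (2 * Real.pi * Complex.I * s) = -σ) :
    (isingKernel V 1 σ).map (fun x : ℝ => (x : ℂ)) * planeWave V s =
      planeWave V s * Matrix.diagonal fun k : Fin (V * 2) =>
        2 * Complex.I * (Real.sin (momentum V s k.val) : ℂ) := by
  ext a k
  rw [Matrix.mul_diagonal, Matrix.mul_apply]
  have hV0 : (V : ℂ) ≠ 0 := by exact_mod_cast (by omega : V ≠ 0)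
  have hz : Complex.exp (Complex.I * momentum V s k.val) ^ (V * 2) = -σ := by
    rw [← hs, ← Complex.exp_nat_mul]
    have e : ((V * 2 : ℕ) : ℂ) * (Complex.I * momentum V s k.val) =
        2 * Real.pi * Complex.I * s + k.val * (2 * Real.pi * Complex.I) := by
      simp only [momentum]
      push_cast
      field_simp
      ring
    rw [e, Complex.exp_add, Complex.exp_nat_mul_two_pi_mul_I, mul_one]
  refine (isingKernel_mulVec_pow hV hσ (Complex.exp_ne_zero _) hz a).trans ?_
  rw [mul_comm, planeWave]
  congr 1
  rw [← Complex.exp_neg, Complex.ofReal_sin, Complex.sin]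
  rw [mul_comm Complex.I, neg_mul]
  linear_combination (Complex.exp (momentum V s k.val * Complex.I)
    - Complex.exp (-(momentum V s k.val * Complex.I))) * Complex.I_mul_I

/-- The shift `s` cancels in momentum differences, leaving a geometric sum over a `2V`-th root of
unity, which is not `1` when `k ≠ l` because `|l - k| < 2V`. -/
theorem conjTranspose_mul_planeWave {V : ℕ} (hV : 1 ≤ V) (s : ℝ) :
    (planeWave V s)ᴴ * planeWave V s = (2 * V : ℂ) • 1 := by
  have hV0 : (V : ℂ) ≠ 0 := by exact_mod_cast (by omega : V ≠ 0)
  ext k l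
  rw [Matrix.mul_apply, Matrix.smul_apply, Matrix.one_apply]
  set ζ : ℂ := Complex.exp (Complex.I * (momentum V s l.val - momentum V s k.val)) with hζ
  have hterm : ∀ a : Fin (V * 2), (planeWave V s)ᴴ k a * planeWave V s a l = ζ ^ a.val := by
    intro a
    rw [Matrix.conjTranspose_apply]
    simp only [planeWave]
    rw [star_pow, ← mul_pow, hζ]
    congr 1
    rw [Complex.star_def, ← Complex.exp_conj, ← Complex.exp_add]
    congr 1
    simp
    ring
  rw [Finset.sum_congr rfl fun a _ => hterm a, Fin.sum_univ_eq_sum_range (fun a => ζ ^ a)]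
  have hζ' : ζ = Complex.exp ((2 * Real.pi * Complex.I) *
      (((l.val : ℂ) - k.val) / (2 * V))) := by
    rw [hζ]
    congr 1
    simp only [momentum]
    push_cast
    field_simp
    ring
  by_cases h : k = l
  · subst h
    simp [hζ, mul_comm]
  · rw [if_neg h, smul_zero]
    have h1 : ζ ≠ 1 := by
      intro h1
      rw [hζ', Complex.exp_eq_one_iff] at h1
      obtain ⟨n, hn⟩ := h1
      have h2 : ((l.val : ℂ) - k.val) / (2 * V) = n := by
        apply mul_left_cancel₀ Complex.two_pi_I_ne_zero
        rw [hn, mul_comm]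
      rw [div_eq_iff (by simpa using hV0)] at h2
      have h3 : (l.val : ℤ) - k.val = n * (2 * V) := by exact_mod_cast h2
      have hl := l.isLt
      have hk := k.isLt
      have h4 : n = 0 := by
        by_contra hn0
        rcases lt_or_gt_of_ne hn0 with h' | h'
        · have : n * (2 * V) ≤ -1 * (2 * V) :=
            mul_le_mul_of_nonneg_right (by omega) (by positivity)
          omega
        · have : 1 * (2 * V) ≤ n * (2 * (V : ℤ)) :=
            mul_le_mul_of_nonneg_right (by omega) (by positivity)
          omega
      rw [h4, zero_mul] at h3
      exact h (Fin.ext (by omega))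
    have h2 : ζ ^ (V * 2) = 1 := by
      rw [hζ', ← Complex.exp_nat_mul]
      have e : ((V * 2 : ℕ) : ℂ) * ((2 * Real.pi * Complex.I) *
          (((l.val : ℂ) - k.val) / (2 * V))) =
          ((l.val - k.val : ℤ) : ℂ) * (2 * Real.pi * Complex.I) := by
        push_cast
        field_simp
      rw [e]
      exact Complex.exp_int_mul_two_pi_mul_I _
    rw [geom_sum_eq h1, h2, sub_self, zero_div]

theorem exp_isingKernel_apply {V : ℕ} (hV : 1 ≤ V) {σ s : ℝ} (hσ : σ * σ = 1)
    (hs : Complex.exp (2 * Real.pi * Complex.I * s) = -σ) (t : ℝ) (a b : Fin (V * 2)) :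
    NormedSpace.exp ((2 * t : ℂ) • (isingKernel V 1 σ).map (fun x : ℝ => (x : ℂ))) a b =
      (2 * V : ℂ)⁻¹ * ∑ k ∈ Finset.range (V * 2), Complex.exp (Complex.I *
        ((momentum V s k * ((a.val : ℝ) - b.val) + 4 * t * Real.sin (momentum V s k) : ℝ) : ℂ)) := by
  have hV0 : (2 * V : ℂ) ≠ 0 := by exact_mod_cast (by omega : 2 * V ≠ 0)
  have hleft : ((2 * V : ℂ)⁻¹ • (planeWave V s)ᴴ) * planeWave V s = 1 := by
    rw [smul_mul_assoc, conjTranspose_mul_planeWave hV, smul_smul, inv_mul_cancel₀ hV0, one_smul]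
  have hinv : (planeWave V s)⁻¹ = (2 * V : ℂ)⁻¹ • (planeWave V s)ᴴ := Matrix.inv_eq_left_inv hleft
  have hunit : IsUnit (planeWave V s) := IsUnit.of_mul_eq_one_right _ hleft
  have hK : (2 * t : ℂ) • (isingKernel V 1 σ).map (fun x : ℝ => (x : ℂ)) =
      planeWave V s * (Matrix.diagonal fun k : Fin (V * 2) =>
        Complex.I * (4 * t * Real.sin (momentum V s k.val) : ℂ)) * (planeWave V s)⁻¹ := by
    have hd : (Matrix.diagonal fun k : Fin (V * 2) =>
        Complex.I * (4 * t * Real.sin (momentum V s k.val) : ℂ)) = (2 * t : ℂ) •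
          Matrix.diagonal fun k : Fin (V * 2) =>
            2 * Complex.I * (Real.sin (momentum V s k.val) : ℂ) := by
      rw [← Matrix.diagonal_smul]
      congr 1
      funext k
      simp only [Pi.smul_apply, smul_eq_mul]
      ring
    rw [hd, mul_smul_comm, smul_mul_assoc, ← isingKernel_mul_planeWave hV hσ hs, mul_assoc,
      hinv, mul_eq_one_comm.mp hleft, mul_one]
  rw [hK, Matrix.exp_conj _ _ hunit, Matrix.exp_diagonal, hinv, mul_smul_comm, Matrix.smul_apply,
    smul_eq_mul, Matrix.mul_apply]
  congr 1
  rw [← Fin.sum_univ_eq_sum_range (fun k => Complex.exp (Complex.I *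
        ((momentum V s k * ((a.val : ℝ) - b.val) + 4 * t * Real.sin (momentum V s k) : ℝ) : ℂ)))]
  refine Finset.sum_congr rfl fun k _ => ?_
  rw [Matrix.mul_diagonal, Matrix.conjTranspose_apply, Pi.coe_exp]
  simp only [planeWave]
  rw [star_pow, Complex.star_def, ← Complex.exp_conj, ← Complex.exp_nat_mul, ← Complex.exp_nat_mul,
    ← Complex.exp_eq_exp_ℂ, ← Complex.exp_add, ← Complex.exp_add]
  congr 1
  simp
  ring

/-- Each column of `Ω` has two nonzero entries, of modulus `1 / √2`, so each of the two
multiplications costs a factor `√2`. -/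
theorem norm_propagator_le {V : ℕ} (g σ t M : ℝ)
    (hM : ∀ a b, ‖NormedSpace.exp ((2 * t : ℂ) •
      (isingKernel V g σ).map (fun x : ℝ => (x : ℂ))) a b‖ ≤ M) (j k : Fin (V * 2)) :
    ‖propagator V g σ t j k‖ ≤ 2 * M := by
  rw [propagator_eq]
  set E := NormedSpace.exp ((2 * t : ℂ) • (isingKernel V g σ).map (fun x : ℝ => (x : ℂ)))
  have hM0 : 0 ≤ M := (norm_nonneg _).trans (hM j k)
  have hr : ‖((Real.sqrt 2 : ℂ))⁻¹‖ * ‖((Real.sqrt 2 : ℂ))⁻¹‖ = 1 / 2 := by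
    rw [← norm_mul, inv_sqrt_two_mul_self]; norm_num
  set r := ‖((Real.sqrt 2 : ℂ))⁻¹‖ with hr'
  have hrow : ∀ b (F : Fin (V * 2) → ℝ), (∀ a, 0 ≤ F a) →
      ∑ a, F a * ‖omega V a b‖ = r * (F (siteIndex b.divNat 0) + F (siteIndex b.divNat 1)) := by
    intro b F hF
    obtain ⟨l, ν, rfl⟩ := exists_siteIndex b
    rw [sum_siteIndex, Finset.sum_eq_single l]
    · rw [omega_siteIndex, omega_siteIndex, if_pos rfl, if_pos rfl, norm_mul, norm_mul,
        siteIndex_divNat, ← hr']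
      fin_cases ν <;> simp <;> ring
    · intro i _ hi
      simp [omega_siteIndex, hi]
    · simp
  have hcol : ∀ b, ‖((omega V)ᴴ * E) j b‖ ≤ r * (M + M) := by
    intro b
    rw [Matrix.mul_apply]
    refine (norm_sum_le _ _).trans ?_
    have : ∀ a, ‖(omega V)ᴴ j a * E a b‖ ≤ M * ‖omega V a j‖ := by
      intro a
      rw [norm_mul, Matrix.conjTranspose_apply, norm_star, mul_comm]
      exact mul_le_mul_of_nonneg_right (hM a b) (norm_nonneg _)
    exact (Finset.sum_le_sum fun a _ => this a).trans (hrow j (fun _ => M) fun _ => hM0).le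
  rw [Matrix.mul_apply]
  refine (norm_sum_le _ _).trans ?_
  have : ∀ a, ‖((omega V)ᴴ * E) j a * omega V a k‖ ≤ r * (M + M) * ‖omega V a k‖ := by
    intro a
    rw [norm_mul]
    exact mul_le_mul_of_nonneg_right (hcol a) (norm_nonneg _)
  refine (Finset.sum_le_sum fun a _ => this a).trans ?_
  have hrM : 0 ≤ r * (M + M) := mul_nonneg (norm_nonneg _) (by linarith)
  rw [hrow k (fun _ => r * (M + M)) fun _ => hrM]
  nlinarith

/-! ## Exponential sums -/

/-- Abel summation: the quantity in the norm is the sum of `(w k - w (k - 1)) * z k` over `1 ≤ k ≤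
n`, and monotonicity of `u` makes the total variation telescope. -/
theorem norm_sum_add_boundary_le (z : ℕ → ℂ) (w : ℕ → ℂ) (u : ℕ → ℝ) (hz : ∀ k, ‖z k‖ = 1)
    (hw : ∀ k, w k = 1 / 2 + Complex.I * u k) (n : ℕ)
    (hzw : ∀ k < n + 1, z k = w k * (z k - z (k + 1)))
    (hu : ∀ k, k + 1 < n + 1 → u k ≤ u (k + 1)) :
    ‖∑ k ∈ Finset.range (n + 1), z k - w 0 * z 0 + w n * z (n + 1)‖ ≤ u n - u 0 := by
  induction n with
  | zero =>
    have h := hzw 0 (by omega)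
    have : ∑ k ∈ Finset.range (0 + 1), z k - w 0 * z 0 + w 0 * z (0 + 1) = 0 := by
      rw [Finset.sum_range_one]
      linear_combination h
    rw [this]; simp
  | succ n ih =>
    have ih' := ih (fun k hk => hzw k (by omega)) (fun k hk => hu k (by omega))
    have h := hzw (n + 1) (by omega)
    have hu' := hu n (by omega)
    have e : ∑ k ∈ Finset.range (n + 1 + 1), z k - w 0 * z 0 + w (n + 1) * z (n + 1 + 1) =
        (∑ k ∈ Finset.range (n + 1), z k - w 0 * z 0 + w n * z (n + 1))
          + (w (n + 1) - w n) * z (n + 1) := by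
      rw [Finset.sum_range_succ]
      linear_combination h
    have h2 : ‖(w (n + 1) - w n) * z (n + 1)‖ = u (n + 1) - u n := by
      have : w (n + 1) - w n = Complex.I * ((u (n + 1) - u n : ℝ) : ℂ) := by
        rw [hw, hw]; push_cast; ring
      rw [norm_mul, hz, mul_one, this, norm_mul, Complex.norm_I, one_mul, Complex.norm_real,
        Real.norm_of_nonneg (by linarith)]
    rw [e]
    refine (norm_add_le _ _).trans ?_
    rw [h2]
    linarith

/-- Summation by parts for a geometric-like sum whose ratios `exp (i θ_k)` stay away from `1`. -/
theorem norm_sum_le_of_sin_ge (z : ℕ → ℂ) (θ : ℕ → ℝ) (hz : ∀ k, ‖z k‖ = 1) (n : ℕ)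
    (hθ : ∀ k < n, z (k + 1) = z k * Complex.exp (Complex.I * θ k)) {μ : ℝ} (hμ : 0 < μ)
    (hsin : ∀ k < n, μ ≤ |Real.sin (θ k / 2)|)
    (hmono : ∀ k, k + 1 < n → 0 ≤ Real.sin (θ k / 2 - θ (k + 1) / 2) ∧
      0 < Real.sin (θ k / 2) * Real.sin (θ (k + 1) / 2)) :
    ‖∑ k ∈ Finset.range n, z k‖ ≤ 3 / μ := by
  rcases n with _ | n
  · simp; positivity
  -- Here `w k = 1 / (1 - exp (i θ k)) = 1/2 + (i/2) cot (θ k / 2)`, so the real part is constant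
  -- and only the cotangent varies.
  set u : ℕ → ℝ := fun k => Real.cos (θ k / 2) / (2 * Real.sin (θ k / 2)) with hu
  set w : ℕ → ℂ := fun k => 1 / 2 + Complex.I * u k with hw
  have hs0 : ∀ k < n + 1, Real.sin (θ k / 2) ≠ 0 := fun k hk h => by
    have := hsin k hk
    rw [h, abs_zero] at this
    linarith
  have hzw : ∀ k < n + 1, z k = w k * (z k - z (k + 1)) := by
    intro k hk
    have hs : Complex.sin ((θ k / 2 : ℝ) : ℂ) ≠ 0 := by
      rw [← Complex.ofReal_sin]
      exact_mod_cast hs0 k hk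
    have e1 : Complex.exp (Complex.I * θ k) =
        (Complex.cos ((θ k / 2 : ℝ) : ℂ) + Complex.sin ((θ k / 2 : ℝ) : ℂ) * Complex.I) ^ 2 := by
      rw [← Complex.exp_mul_I, ← Complex.exp_nat_mul]
      congr 1
      push_cast
      ring
    have e2 := Complex.sin_sq_add_cos_sq ((θ k / 2 : ℝ) : ℂ)
    rw [hθ k hk, e1]
    simp only [hw, hu]
    rw [Complex.ofReal_div, Complex.ofReal_mul, Complex.ofReal_cos, Complex.ofReal_sin]
    generalize Complex.sin ((θ k / 2 : ℝ) : ℂ) = S at *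
    generalize Complex.cos ((θ k / 2 : ℝ) : ℂ) = C at *
    have hI := Complex.I_sq
    have key : (1 / 2 + Complex.I * (C / (((2 : ℝ) : ℂ) * S))) *
        (1 - (C + S * Complex.I) ^ 2) = 1 := by
      push_cast
      field_simp
      have hI3 : Complex.I ^ 3 = -Complex.I := by rw [pow_succ, hI]; ring
      ring_nf
      rw [hI, hI3]
      linear_combination (S + Complex.I * C) * (-1) * e2 + 2 * S * e2
    linear_combination (-z k) * key
  have huM : ∀ k < n + 1, |u k| ≤ 1 / (2 * μ) := by
    intro k hk
    simp only [hu]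
    rw [abs_div, abs_mul, abs_two]
    have h1 := Real.abs_cos_le_one (θ k / 2)
    have h2 := hsin k hk
    exact div_le_div₀ zero_le_one h1 (by positivity) (by linarith)
  have hwM : ∀ k < n + 1, ‖w k‖ ≤ 1 / 2 + 1 / (2 * μ) := by
    intro k hk
    refine (norm_add_le _ _).trans ?_
    rw [norm_mul, Complex.norm_I, one_mul, Complex.norm_real, Real.norm_eq_abs]
    have := huM k hk
    have h2 : ‖(1 / 2 : ℂ)‖ = 1 / 2 := by norm_num
    linarith
  have humono : ∀ k, k + 1 < n + 1 → u k ≤ u (k + 1) := by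
    intro k hk
    obtain ⟨h1, h2⟩ := hmono k hk
    have s1 := hs0 k (by omega)
    have s2 := hs0 (k + 1) hk
    rw [Real.sin_sub] at h1
    have : u (k + 1) - u k = (Real.sin (θ k / 2) * Real.cos (θ (k + 1) / 2)
        - Real.cos (θ k / 2) * Real.sin (θ (k + 1) / 2)) /
          (2 * (Real.sin (θ k / 2) * Real.sin (θ (k + 1) / 2))) := by
      simp only [hu]
      field_simp
    have h3 : 0 ≤ u (k + 1) - u k := by
      rw [this]
      exact div_nonneg h1 (by positivity)
    linarith
  have hmain := norm_sum_add_boundary_le z w u hz (fun k => rfl) n hzw humono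
  have e : ∑ k ∈ Finset.range (n + 1), z k =
      (∑ k ∈ Finset.range (n + 1), z k - w 0 * z 0 + w n * z (n + 1))
        + (w 0 * z 0 - w n * z (n + 1)) := by ring
  rw [e]
  have hb : ‖w 0 * z 0 - w n * z (n + 1)‖ ≤ ‖w 0‖ + ‖w n‖ := by
    refine (norm_sub_le _ _).trans ?_
    rw [norm_mul, norm_mul, hz, hz, mul_one, mul_one]
  have h0 := abs_le.mp (huM 0 (by omega))
  have hn := abs_le.mp (huM n (by omega))
  have w0 := hwM 0 (by omega)
  have wn := hwM n (by omega)
  -- The variation contributes at most `1 / μ` and the two boundary terms at most `1 + 1 / μ`; the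
  -- remaining `1` is absorbed since `μ ≤ 1`.
  have hμ1 : μ ≤ 1 := (hsin 0 (by omega)).trans (Real.abs_sin_le_one _)
  have h1 : 1 ≤ 1 / μ := by rw [le_div_iff₀ hμ]; linarith
  have h2 : 1 / (2 * μ) = 1 / μ / 2 := by field_simp
  have h3 : 3 / μ = 3 * (1 / μ) := by ring
  refine (norm_add_le _ _).trans ?_
  rw [h2] at h0 hn w0 wn
  rw [h3]
  linarith

theorem div_pi_le_sin {lam x : ℝ} (h0 : 0 < lam) (h1 : lam ≤ 1) (hx : lam / 2 ≤ x)
    (hx' : x ≤ (Real.pi + 1) / 2) : lam / Real.pi ≤ Real.sin x := by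
  have hpi := Real.pi_gt_three
  have aux : ∀ y, lam / 2 ≤ y → y ≤ Real.pi / 2 → lam / Real.pi ≤ Real.sin y := by
    intro y hy hy'
    refine le_trans ?_ (Real.mul_le_sin (by linarith) hy')
    rw [div_mul_eq_mul_div]
    exact div_le_div_of_nonneg_right (by linarith) Real.pi_pos.le
  -- Jordan's inequality applies directly or after reflection, since `π - x ≥ (π - 1) / 2 ≥ lam /
  -- 2`.
  rcases le_total x (Real.pi / 2) with h | h
  · exact aux x hx h
  · rw [← Real.sin_pi_sub]
    exact aux _ (by linarith) (by linarith)

/-- The first derivative test for increasing or decreasing phases. -/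
theorem norm_sum_le_of_phase_ge (z : ℕ → ℂ) (θ : ℕ → ℝ) (hz : ∀ k, ‖z k‖ = 1) (n : ℕ)
    (hθ : ∀ k < n, z (k + 1) = z k * Complex.exp (Complex.I * θ k))
    (hanti : ∀ k, k + 1 < n → θ (k + 1) ≤ θ k) {lam : ℝ} (h0 : 0 < lam) (h1 : lam ≤ 1)
    (h : (∀ k < n, lam ≤ θ k ∧ θ k ≤ Real.pi + 1) ∨
      (∀ k < n, θ k ≤ -lam ∧ -(Real.pi + 1) ≤ θ k)) :
    ‖∑ k ∈ Finset.range n, z k‖ ≤ 3 * Real.pi / lam := by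
  have hpi := Real.pi_gt_three
  have hμ : 0 < lam / Real.pi := by positivity
  have e : 3 * Real.pi / lam = 3 / (lam / Real.pi) := by field_simp
  rw [e]
  rcases h with h | h
  · have hs : ∀ k < n, lam / Real.pi ≤ Real.sin (θ k / 2) := fun k hk =>
      div_pi_le_sin h0 h1 (by linarith [(h k hk).1]) (by linarith [(h k hk).2])
    refine norm_sum_le_of_sin_ge z θ hz n hθ hμ
      (fun k hk => (hs k hk).trans (le_abs_self _)) fun k hk => ⟨?_, ?_⟩
    · have a1 := h k (by omega)
      have a2 := h (k + 1) hk
      have a3 := hanti k hk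
      exact Real.sin_nonneg_of_nonneg_of_le_pi (by linarith) (by linarith)
    · exact mul_pos (hμ.trans_le (hs k (by omega))) (hμ.trans_le (hs _ hk))
  · have hs : ∀ k < n, lam / Real.pi ≤ -Real.sin (θ k / 2) := fun k hk => by
      rw [← Real.sin_neg]
      exact div_pi_le_sin h0 h1 (by linarith [(h k hk).1]) (by linarith [(h k hk).2])
    refine norm_sum_le_of_sin_ge z θ hz n hθ hμ
      (fun k hk => (hs k hk).trans (neg_le_abs _)) fun k hk => ⟨?_, ?_⟩
    · have a1 := h k (by omega)
      have a2 := h (k + 1) hk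
      have a3 := hanti k hk
      exact Real.sin_nonneg_of_nonneg_of_le_pi (by linarith) (by linarith)
    · have b1 := hs k (by omega)
      have b2 := hs (k + 1) hk
      exact mul_pos_of_neg_of_neg (by linarith) (by linarith)

theorem exists_threshold (n : ℕ) (P : ℕ → Prop)
    (hP : ∀ i j, i ≤ j → j < n → P j → P i) :
    ∃ m ≤ n, (∀ k < m, P k) ∧ ∀ k, m ≤ k → k < n → ¬ P k := by
  classical
  have hex : ∃ k, ¬ (k < n ∧ P k) := ⟨n, fun h => lt_irrefl _ h.1⟩
  refine ⟨Nat.find hex, Nat.find_min' hex fun h => lt_irrefl _ h.1, fun k hk => ?_,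
    fun k hk hkn hPk => ?_⟩
  · exact (not_not.mp (Nat.find_min hex hk)).2
  · exact Nat.find_spec hex ⟨hk.trans_lt hkn, hP _ _ hk hkn hPk⟩

/-- In the product formula both sines are at least `(β - α) / π`: the midpoint is at distance at
least `(β - α) / 2` from both `0` and `π`. The quadratic rate, forced by the flat ends of the
cosine, is the source of the exponent `1/3`. -/
theorem cos_sub_cos_ge {α β : ℝ} (h0 : 0 ≤ α) (hαβ : α ≤ β) (hβ : β ≤ Real.pi) :
    2 * ((β - α) / Real.pi) ^ 2 ≤ Real.cos α - Real.cos β := by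
  have hpi := Real.pi_pos
  have e : Real.cos α - Real.cos β = 2 * Real.sin ((α + β) / 2) * Real.sin ((β - α) / 2) := by
    rw [Real.cos_sub_cos, ← neg_sub β α, neg_div, Real.sin_neg]; ring
  have h1 : (β - α) / Real.pi ≤ Real.sin ((β - α) / 2) := by
    refine le_trans (le_of_eq ?_) (Real.mul_le_sin (by linarith) (by linarith))
    field_simp
  have h2 : Real.sin ((β - α) / 2) ≤ Real.sin ((α + β) / 2) := by
    rcases le_total ((α + β) / 2) (Real.pi / 2) with h | h
    · exact Real.sin_le_sin_of_le_of_le_pi_div_two (by linarith) h (by linarith)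
    · rw [← Real.sin_pi_sub ((α + β) / 2)]
      exact Real.sin_le_sin_of_le_of_le_pi_div_two (by linarith) (by linarith) (by linarith)
  have h3 : 0 ≤ (β - α) / Real.pi := div_nonneg (by linarith) hpi.le
  rw [e]
  nlinarith

/-- An exponential sum over half a period, with phase increments `c + A cos q_k`. -/
theorem norm_sum_half_period_le (V : ℕ) (hV : 1 ≤ V) (z : ℕ → ℂ) (hz : ∀ k, ‖z k‖ = 1)
    {c A s lam : ℝ} (hc : |c| ≤ Real.pi) (hA : 0 < A) (hA1 : A ≤ 1) (hs : 0 ≤ s) (hs1 : s ≤ 1)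
    (h0 : 0 < lam) (h1 : lam ≤ 1)
    (hθ : ∀ k < V, z (k + 1) =
      z k * Complex.exp (Complex.I * ((c + A * Real.cos (Real.pi / V * (k + s)) : ℝ) : ℂ))) :
    ‖∑ k ∈ Finset.range V, z k‖ ≤ 6 * Real.pi / lam + 1 + V * Real.sqrt (lam / A) := by
  have hpi := Real.pi_pos
  have hVpos : (0 : ℝ) < V := by exact_mod_cast hV
  set q : ℕ → ℝ := fun k => Real.pi / V * (k + s) with hq
  set θ : ℕ → ℝ := fun k => c + A * Real.cos (q k) with hθdef
  have hq0 : ∀ k, 0 ≤ q k := fun k => by simp only [hq]; positivity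
  have hqpi : ∀ k < V, q k ≤ Real.pi := by
    intro k hk
    simp only [hq]
    rw [div_mul_eq_mul_div, div_le_iff₀ hVpos]
    have : (k : ℝ) + 1 ≤ V := by exact_mod_cast hk
    nlinarith
  have hqmono : ∀ i j, i ≤ j → q i ≤ q j := by
    intro i j hij
    have : (i : ℝ) ≤ j := by exact_mod_cast hij
    simp only [hq]
    gcongr
  have hanti : ∀ i j, i ≤ j → j < V → θ j ≤ θ i := by
    intro i j hij hj
    have := Real.cos_le_cos_of_nonneg_of_le_pi (hq0 i) (hqpi j hj) (hqmono i j hij)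
    simp only [hθdef]
    nlinarith
  have hbd : ∀ k, -(Real.pi + 1) ≤ θ k ∧ θ k ≤ Real.pi + 1 := by
    intro k
    have h2 := abs_le.mp hc
    have h3 := Real.neg_one_le_cos (q k)
    have h4 := Real.cos_le_one (q k)
    simp only [hθdef]
    constructor <;> nlinarith
  -- As `θ` decreases, the range splits into increments `≥ lam`, then those in `(-lam, lam)`, then
  -- those `≤ -lam`.
  obtain ⟨m, hmV, hm1, hm2⟩ := exists_threshold V (fun k => lam ≤ θ k)
    (fun i j hij hj h => h.trans (hanti i j hij hj))
  obtain ⟨n, hnV, hn1, hn2⟩ := exists_threshold V (fun k => -lam < θ k)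
    (fun i j hij hj h => lt_of_lt_of_le h (hanti i j hij hj))
  have hmn : m ≤ n := by
    by_contra! h
    have := hm1 n h
    exact hn2 n le_rfl (by omega) (by linarith)
  have hS1 : ‖∑ k ∈ Finset.range m, z k‖ ≤ 3 * Real.pi / lam :=
    norm_sum_le_of_phase_ge z θ hz m (fun k hk => hθ k (by omega))
      (fun k hk => hanti k (k + 1) (by omega) (by omega)) h0 h1
      (Or.inl fun k hk => ⟨hm1 k hk, (hbd k).2⟩)
  have hS3 : ‖∑ k ∈ Finset.range (V - n), z (n + k)‖ ≤ 3 * Real.pi / lam :=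
    norm_sum_le_of_phase_ge (fun k => z (n + k)) (fun k => θ (n + k)) (fun k => hz _) (V - n)
      (fun k hk => hθ (n + k) (by omega))
      (fun k hk => hanti (n + k) (n + (k + 1)) (by omega) (by omega)) h0 h1
      (Or.inr fun k hk => ⟨not_lt.mp (hn2 (n + k) (by omega) (by omega)), (hbd _).1⟩)
  have hS2 : ‖∑ k ∈ Finset.Ico m n, z k‖ ≤ 1 + V * Real.sqrt (lam / A) := by
    have hcard : ‖∑ k ∈ Finset.Ico m n, z k‖ ≤ (n - m : ℕ) := by
      refine (norm_sum_le _ _).trans ?_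
      simp [hz]
    refine hcard.trans ?_
    rcases Nat.eq_zero_or_pos (n - m) with h | h
    · rw [h]; simp; positivity
    · have b1 : θ m < lam := not_le.mp (hm2 m le_rfl (by omega))
      have b2 : -lam < θ (n - 1) := hn1 (n - 1) (by omega)
      have b3 := cos_sub_cos_ge (hq0 m) (hqmono m (n - 1) (by omega)) (hqpi (n - 1) (by omega))
      have b4 : (q (n - 1) - q m) / Real.pi = ((n - m : ℕ) - 1 : ℝ) / V := by
        simp only [hq]
        rw [Nat.cast_sub hmn, Nat.cast_sub (by omega : 1 ≤ n)]
        push_cast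
        field_simp
        ring
      rw [b4] at b3
      simp only [hθdef] at b1 b2
      -- Across the middle range `A cos q` drops by less than `2 lam`, whereas it must drop by at
      -- least `2A` times the square on the left.
      have b5 : (((n - m : ℕ) - 1 : ℝ) / V) ^ 2 ≤ lam / A := by
        rw [le_div_iff₀ hA]
        nlinarith
      have b6 := Real.le_sqrt_of_sq_le b5
      rw [div_le_iff₀ hVpos] at b6
      linarith
  have hsplit : ∑ k ∈ Finset.range V, z k = ∑ k ∈ Finset.range m, z k
      + ∑ k ∈ Finset.Ico m n, z k + ∑ k ∈ Finset.range (V - n), z (n + k) := by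
    rw [Finset.sum_range_add_sum_Ico _ hmn, ← Finset.sum_Ico_eq_sum_range,
      Finset.sum_range_add_sum_Ico _ hnV]
  rw [hsplit]
  refine (norm_add₃_le).trans ?_
  have : 6 * Real.pi / lam = 3 * Real.pi / lam + 3 * Real.pi / lam := by ring
  linarith

/-! ### The exponential sum over all momenta -/

theorem exists_int_abs_sub_le_pi (x : ℝ) : ∃ n : ℤ, |x - n * (2 * Real.pi)| ≤ Real.pi := by
  have hpi := Real.pi_pos
  refine ⟨round (x / (2 * Real.pi)), ?_⟩
  have h := abs_sub_round (x / (2 * Real.pi))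
  have e : x - round (x / (2 * Real.pi)) * (2 * Real.pi) =
      (x / (2 * Real.pi) - round (x / (2 * Real.pi))) * (2 * Real.pi) := by
    field_simp
  rw [e, abs_mul, abs_of_pos (by positivity : 0 < 2 * Real.pi)]
  nlinarith

/-- The phase `p_k d + 4 t sin p_k` of the propagator at the momentum `p_k`. -/
def phase (V : ℕ) (s d t : ℝ) (k : ℕ) : ℝ :=
  momentum V s k * d + 4 * t * Real.sin (momentum V s k)

/-- The difference of sines is a cosine at the midpoint of the two momenta, hence the shift `s +
1/2`. -/
theorem phase_succ (V : ℕ) (s d t : ℝ) (k : ℕ) :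
    phase V s d t (k + 1) = phase V s d t k + (Real.pi / V * d +
      8 * t * Real.sin (Real.pi / V / 2) * Real.cos (Real.pi / V * (k + (s + 1 / 2)))) := by
  have e1 : momentum V s (k + 1) = momentum V s k + Real.pi / V := by
    simp only [momentum]; push_cast; ring
  have e2 : Real.pi / V * (k + (s + 1 / 2)) = momentum V s k + Real.pi / V / 2 := by
    simp only [momentum]; ring
  have e3 : Real.sin (momentum V s k + Real.pi / V) - Real.sin (momentum V s k) =
      2 * Real.sin (Real.pi / V / 2) * Real.cos (momentum V s k + Real.pi / V / 2) := by
    rw [Real.sin_sub_sin]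
    congr 3 <;> ring
  rw [phase, phase, e1, e2]
  linear_combination 4 * t * e3

theorem norm_sum_phase_le {V : ℕ} (hV : 1 ≤ V) {s : ℝ} (hs : 0 ≤ s) (hs1 : s ≤ 1 / 2) (d : ℝ)
    {t r : ℝ} (hr : 1 ≤ r) (hrt : t = r ^ 3) (htV : 4 * Real.pi * t ≤ V) :
    ‖∑ k ∈ Finset.range (V * 2), Complex.exp (Complex.I * (phase V s d t k : ℂ))‖ ≤
      16 * V / r := by
  have hpi := Real.pi_pos
  have hpi3 := Real.pi_gt_three
  have hpi4 := Real.pi_le_four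
  have hVpos : (0 : ℝ) < V := by exact_mod_cast hV
  have hV1 : (1 : ℝ) ≤ V := by exact_mod_cast hV
  have hr0 : 0 < r := by linarith
  have hrt' : r ≤ t := hrt ▸ le_self_pow₀ hr (by norm_num)
  have ht0 : 0 < t := by linarith
  -- Only the increments modulo `2π` matter, so the linear part may be reduced to `|c| ≤ π`,
  -- whatever the size of `d`.
  obtain ⟨n, hn⟩ := exists_int_abs_sub_le_pi (Real.pi / V * d)
  set c : ℝ := Real.pi / V * d - n * (2 * Real.pi) with hc
  set A : ℝ := 8 * t * Real.sin (Real.pi / V / 2) with hA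
  set z : ℕ → ℂ := fun k => Complex.exp (Complex.I * (phase V s d t k : ℂ)) with hzdef
  have hz : ∀ k, ‖z k‖ = 1 := fun k => by
    simp only [hzdef]
    rw [mul_comm, Complex.norm_exp_ofReal_mul_I]
  have hδ : Real.pi / V ≤ Real.pi := div_le_self hpi.le hV1
  have hδ0 : 0 < Real.pi / V := by positivity
  have hAlow : 8 * t / V ≤ A := by
    have h := Real.mul_le_sin (x := Real.pi / V / 2) (by positivity) (by linarith)
    have e : 8 * t / V = 8 * t * (2 / Real.pi * (Real.pi / V / 2)) := by field_simp
    rw [e, hA]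
    exact mul_le_mul_of_nonneg_left h (by positivity)
  have hA0 : 0 < A := lt_of_lt_of_le (by positivity) hAlow
  have hA1 : A ≤ 1 := by
    have h := Real.sin_le (x := Real.pi / V / 2) (by positivity)
    have h2 : A ≤ 8 * t * (Real.pi / V / 2) := mul_le_mul_of_nonneg_left h (by positivity)
    have e : 8 * t * (Real.pi / V / 2) = 4 * Real.pi * t / V := by ring
    rw [e] at h2
    exact h2.trans ((div_le_one hVpos).mpr htV)
  have hstep : ∀ k, z (k + 1) = z k * Complex.exp (Complex.I *
      ((c + A * Real.cos (Real.pi / V * (k + (s + 1 / 2))) : ℝ) : ℂ)) := by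
    intro k
    simp only [hzdef]
    rw [phase_succ, ← Complex.exp_add, Complex.exp_eq_exp_iff_exists_int]
    refine ⟨n, ?_⟩
    rw [hc, hA]
    push_cast
    ring
  -- The choice `lam = π r / V` gives `6π / lam = 6V / r`, and `lam / A ≤ π / (8 r²) ≤ 1 / r²`. With
  -- `1 ≤ V / r` each half period contributes at most `8V / r`.
  have hlam0 : 0 < Real.pi * r / V := by positivity
  have hlam1 : Real.pi * r / V ≤ 1 := by
    rw [div_le_one hVpos]
    nlinarith
  have hhalf1 := norm_sum_half_period_le V hV z hz hn hA0 hA1 (by linarith : 0 ≤ s + 1 / 2)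
    (by linarith) hlam0 hlam1 fun k _ => hstep k
  -- On the second half period the cosine changes sign; complex conjugation restores a decreasing
  -- increment, with `-c` in place of `c`.
  have hhalf2 := norm_sum_half_period_le V hV (fun k => (starRingEnd ℂ) (z (V + k)))
    (fun k => by rw [RCLike.norm_conj, hz]) (c := -c) (by rwa [abs_neg]) hA0 hA1
    (by linarith : 0 ≤ s + 1 / 2) (by linarith) hlam0 hlam1 (by
      intro k _
      rw [← add_assoc, hstep, map_mul]
      congr 1
      have e : Real.pi / V * (((V + k : ℕ) : ℝ) + (s + 1 / 2)) =
          Real.pi / V * (k + (s + 1 / 2)) + Real.pi := by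
        push_cast
        field_simp
        ring
      rw [e, Real.cos_add_pi, ← Complex.exp_conj, map_mul, Complex.conj_I, Complex.conj_ofReal]
      congr 1
      push_cast
      ring)
  rw [← map_sum, RCLike.norm_conj] at hhalf2
  have hsqrt : Real.sqrt (Real.pi * r / V / A) ≤ 1 / r := by
    apply Real.sqrt_le_iff.mpr
    refine ⟨by positivity, ?_⟩
    rw [div_le_iff₀ hA0, div_pow, one_pow, div_mul_eq_mul_div, one_mul,
      le_div_iff₀ (by positivity)]
    refine le_trans ?_ hAlow
    rw [div_mul_eq_mul_div]
    refine div_le_div_of_nonneg_right ?_ hVpos.le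
    have : Real.pi * r * r ^ 2 = Real.pi * t := by rw [hrt]; ring
    rw [this]
    nlinarith
  have h1 : 6 * Real.pi / (Real.pi * r / V) = 6 * (V / r) := by field_simp
  have h2 : 1 ≤ V / r := by
    rw [one_le_div hr0]
    nlinarith
  have h3 : V * Real.sqrt (Real.pi * r / V / A) ≤ V / r :=
    (mul_le_mul_of_nonneg_left hsqrt hVpos.le).trans_eq (mul_one_div _ _)
  have hsplit : ∑ k ∈ Finset.range (V * 2), z k =
      ∑ k ∈ Finset.range V, z k + ∑ k ∈ Finset.range V, z (V + k) := by
    rw [mul_two, Finset.sum_range_add]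
  rw [hsplit]
  refine (norm_add_le _ _).trans ?_
  rw [h1] at hhalf1 hhalf2
  have e : 16 * V / r = 16 * (V / r) := by ring
  rw [e]
  linarith

/-! ### Bounds on the propagator -/

theorem exists_momentum_shift {σ : ℝ} (hσ : σ = 1 ∨ σ = -1) : ∃ s : ℝ, 0 ≤ s ∧ s ≤ 1 / 2 ∧
    Complex.exp (2 * Real.pi * Complex.I * s) = -σ := by
  -- The even sector has antiperiodic plane waves (half-integer momenta), the odd sector periodic
  -- ones.
  rcases hσ with rfl | rfl
  · refine ⟨1 / 2, by norm_num, le_rfl, ?_⟩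
    have : 2 * Real.pi * Complex.I * ((1 / 2 : ℝ) : ℂ) = Real.pi * Complex.I := by
      push_cast; ring
    rw [this, Complex.exp_pi_mul_I]
    simp
  · exact ⟨0, le_rfl, by norm_num, by simp⟩

theorem norm_propagator_le_two {V : ℕ} (hV : 1 ≤ V) {σ : ℝ} (hσ : σ = 1 ∨ σ = -1) (t : ℝ)
    (j k : Fin (V * 2)) : ‖propagator V 1 σ t j k‖ ≤ 2 := by
  obtain ⟨s, -, -, hs⟩ := exists_momentum_shift hσ
  have hσ2 : σ * σ = 1 := by rcases hσ with rfl | rfl <;> norm_num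
  have hV0 : (V : ℝ) ≠ 0 := by exact_mod_cast (by omega : V ≠ 0)
  refine (norm_propagator_le 1 σ t 1 (fun a b => ?_) j k).trans (by norm_num)
  rw [exp_isingKernel_apply hV hσ2 hs, norm_mul]
  have h : ‖∑ k ∈ Finset.range (V * 2), Complex.exp (Complex.I *
      ((momentum V s k * ((a.val : ℝ) - b.val) + 4 * t * Real.sin (momentum V s k) : ℝ) : ℂ))‖ ≤
      2 * V := by
    refine (norm_sum_le _ _).trans ?_
    simp only [mul_comm Complex.I, Complex.norm_exp_ofReal_mul_I]
    simp [mul_comm]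
  have h2 : ‖(2 * V : ℂ)⁻¹‖ = (2 * V : ℝ)⁻¹ := by simp
  rw [h2]
  refine (mul_le_mul_of_nonneg_left h (by positivity)).trans ?_
  rw [inv_mul_cancel₀ (by simpa using hV0)]

theorem norm_propagator_le_of_le {V : ℕ} (hV : 1 ≤ V) {σ : ℝ} (hσ : σ = 1 ∨ σ = -1) {t r : ℝ}
    (hr : 1 ≤ r) (hrt : t = r ^ 3) (htV : 4 * Real.pi * t ≤ V)
    (j k : Fin (V * 2)) : ‖propagator V 1 σ t j k‖ ≤ 16 / r := by
  obtain ⟨s, hs0, hs1, hs⟩ := exists_momentum_shift hσ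
  have hσ2 : σ * σ = 1 := by rcases hσ with rfl | rfl <;> norm_num
  have hV0 : (V : ℝ) ≠ 0 := by exact_mod_cast (by omega : V ≠ 0)
  refine (norm_propagator_le 1 σ t (8 / r) (fun a b => ?_) j k).trans (le_of_eq (by ring))
  rw [exp_isingKernel_apply hV hσ2 hs, norm_mul]
  have h2 : ‖(2 * V : ℂ)⁻¹‖ = (2 * V : ℝ)⁻¹ := by simp
  rw [h2]
  refine (mul_le_mul_of_nonneg_left (norm_sum_phase_le hV hs0 hs1 ((a.val : ℝ) - b.val) hr hrt htV)
    (by positivity)).trans (le_of_eq ?_)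
  field_simp
  norm_num

theorem norm_propagator_le_rpow {V : ℕ} (hV : 1 ≤ V) {σ : ℝ} (hσ : σ = 1 ∨ σ = -1) {t : ℝ}
    (ht : 0 < t) (htV : t ≤ (V : ℝ) ^ (6 / 7 : ℝ)) (j k : Fin (V * 2)) :
    ‖propagator V 1 σ t j k‖ ≤ 338 * t ^ (-(1 / 3) : ℝ) := by
  have hVpos : (0 : ℝ) < V := by exact_mod_cast hV
  have hpi4 := Real.pi_lt_d2
  set r : ℝ := t ^ (1 / 3 : ℝ) with hr
  have hr0 : 0 < r := Real.rpow_pos_of_pos ht _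
  have hrt : t = r ^ 3 := by
    rw [hr, ← Real.rpow_natCast, ← Real.rpow_mul ht.le]
    norm_num
  have hneg : t ^ (-(1 / 3) : ℝ) = 1 / r := by
    rw [Real.rpow_neg ht.le, inv_eq_one_div]
  have htwo := norm_propagator_le_two hV hσ t j k
  rw [hneg, mul_one_div]
  -- The constant is `338 = 2 * 169`, with `169 = 13²` coming from the exceptional case below.
  have htriv : r ≤ 169 → ‖propagator V 1 σ t j k‖ ≤ 338 / r := by
    intro h
    refine htwo.trans ?_
    rw [le_div_iff₀ hr0]
    linarith
  by_cases hr1 : 1 ≤ r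
  · by_cases h : 4 * Real.pi * t ≤ V
    · refine (norm_propagator_le_of_le hV hσ hr1 hrt h j k).trans ?_
      exact div_le_div_of_nonneg_right (by norm_num) hr0.le
    · apply htriv
      set x : ℝ := (V : ℝ) ^ (1 / 7 : ℝ) with hx
      have hx0 : 0 < x := Real.rpow_pos_of_pos hVpos _
      have hx6 : (V : ℝ) ^ (6 / 7 : ℝ) = x ^ 6 := by
        rw [hx, ← Real.rpow_natCast, ← Real.rpow_mul hVpos.le]
        norm_num
      have hx7 : (V : ℝ) = x ^ 7 := by
        rw [hx, ← Real.rpow_natCast, ← Real.rpow_mul hVpos.le]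
        norm_num
      rw [hx6] at htV
      -- Here `x ^ 7 = V < 4πt ≤ 4π x ^ 6` and `4π < 13`; then `r ^ 3 = t ≤ 13 ^ 6 = 169 ^ 3`.
      have hx13 : x < 13 := by
        have h1 : x ^ 6 * x < x ^ 6 * 13 := by
          have : x ^ 7 < 4 * Real.pi * t := hx7 ▸ not_le.mp h
          nlinarith [pow_pos hx0 6]
        exact lt_of_mul_lt_mul_left h1 (by positivity)
      have h2 : r ^ 3 ≤ 169 ^ 3 := by
        rw [← hrt]
        refine htV.trans ((pow_le_pow_left₀ hx0.le hx13.le 6).trans ?_)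
        norm_num
      exact le_of_pow_le_pow_left₀ (by norm_num) (by norm_num) h2
  · exact htriv (by linarith)

end CriticalIsing

end

theorem mainTheorem2 :
    ∃ C : ℝ, 0 < C ∧ ∀ V : ℕ, 1 ≤ V → ∀ σ : ℝ, (σ = 1 ∨ σ = -1) →
      (∀ ψ : (Fin V → Fin 2) → ℂ, CriticalIsing.parityOp V *ᵥ ψ = (σ : ℂ) • ψ →
        CriticalIsing.isingHamiltonian V 1 *ᵥ ψ = CriticalIsing.sectorHamiltonian V 1 σ *ᵥ ψ) ∧
      (∀ (t : ℝ) (j : Fin (V * 2)),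
        CriticalIsing.heisenberg (CriticalIsing.sectorHamiltonian V 1 σ) (CriticalIsing.cOp j) t =
          ∑ k : Fin (V * 2), CriticalIsing.propagator V 1 σ t j k • CriticalIsing.cOp k) ∧
      (∀ t : ℝ, 0 < t → t ≤ (V : ℝ) ^ (6 / 7 : ℝ) → ∀ j k : Fin (V * 2),
        ‖CriticalIsing.propagator V 1 σ t j k‖ ≤ C * t ^ (-(1 / 3) : ℝ)) := by
  refine ⟨338, by norm_num, fun V hV σ hσ => ⟨fun ψ hψ => ?_, fun t j => ?_,
    fun t ht htV j k => CriticalIsing.norm_propagator_le_rpow hV hσ ht htV j k⟩⟩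
  · exact CriticalIsing.isingHamiltonian_mulVec_eq hV 1
      (by rcases hσ with rfl | rfl <;> norm_num) ψ hψ
  · exact CriticalIsing.heisenberg_cOp 1 σ t j
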